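/- Let $X$ be a Banach space over $\mathbb{K}\in\{\mathbb{R},\mathbb{C}\}$, let $\xi$ be an ordinal, and let $K\subset X^*$ be weak$^*$-compact. For $L\subset X^*$ and $\varepsilon>0$ let $s_\varepsilon(L)$ be the set of those $x^*\in L$ such that $\operatorname{diam}(V\cap L)>\varepsilon$ (norm diameter) for every weak$^*$-neighborhood $V$ of $x^*$. Put $s_\varepsilon^0(L)=L$, $s_\varepsilon^{\zeta+1}(L)=s_\varepsilon(s_\varepsilon^\zeta(L))$, and $s_\varepsilon^\zeta(L)=\bigcap_{\eta<\zeta}s_\varepsilon^\eta(L)$ for limit ordinals $\zeta$; put $s_\varepsilon^\zeta(L)=L$ for $\varepsilon\le 0$. Let $Sz(L,\varepsilon)$ be the least ordinal $\zeta$ with $s^\zeta_\varepsilon(L)=\varnothing$ ($\infty$ if there is none), and $Sz(L)=\sup_{\varepsilon>0}Sz(L,\varepsilon)$. For $1\le q<\infty$, $L$ has \emph{$\xi$-$q$-summable Szlenk index} if there is $M\ge 0$ such that $\sum_{i=1}^n\varepsilon_i^q\le M^q$ whenever $\varepsilon_1,\dots,\varepsilon_n\ge 0$ and $s^{\omega^\xi}_{\varepsilon_1}\cdots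 s^{\omega^\xi}_{\varepsilon_n}(L)\neq\varnothing$. For non-empty weak$^*$-compact $L$, the \emph{$\xi$-Szlenk power type} is $\mathbf{p}_\xi(L)=\limsup_{\varepsilon\to0^+}\frac{\log Sz_\xi(L,\varepsilon)}{|\log\varepsilon|}\in[0,\infty]$ if $Sz(L)\le\omega^{\xi+1}$, where $Sz_\xi(L,\varepsilon)$ is the least $n\in\mathbb{N}$ with $Sz(L,\varepsilon)\le\omega^\xi n$, and $\mathbf{p}_\xi(L)=\infty$ if $Sz(L)>\omega^{\xi+1}$. Let $\widetilde K=\overline{\mathrm{abs\,co}}^{\,\mathrm{weak}^*}(K)$ be the weak$^*$-closed absolutely convex hull of $K$. Then: (i) For every $1\le q<\infty$, $K$ has $\xi$-$q$-summable Szlenk index if and only if $\widetilde K$ does. (ii) If $Sz(K)>\omega^\xi$, then $\mathbf{p}_\xi(\widetilde K)=\max\{\mathbf{p}_\xi(K),1\}$. If $K\neq\varnothing$ and $Sz(K)\le\omega^\xi$, then $\mathbf{p}_\xi(K)=\mathbf{p}_\xi(\widetilde K)=0$. -/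

import Mathlib

open Filter Topology

open scoped ComplexOrder

universe u v w

noncomputable section

namespace SzlenkIndex

variable {𝕜 : Type u} [RCLike 𝕜] {X : Type v} [NormedAddCommGroup X] [NormedSpace 𝕜 X]

/-- The derivation `s_ε(K)` for `ε > 0`: the points `x*` of `K` such that, for every
weak*-neighbourhood `V` of `x*`, the norm diameter of `V ∩ K` is greater than `ε`, that is, `V ∩ K`
contains two points at norm distance greater than `ε`. By convention `s_ε(K) = K` for `ε ≤ 0`. -/
def szlenkDeriv (ε : ℝ) (K : Set (WeakDual 𝕜 X)) : Set (WeakDual 𝕜 X) :=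
  {x | x ∈ K ∧ (0 < ε → ∀ V ∈ 𝓝 x, ∃ y ∈ V ∩ K, ∃ z ∈ V ∩ K,
    ε < ‖WeakDual.toStrongDual y - WeakDual.toStrongDual z‖)}

/-- The transfinite derivations: `s_ε^0(K) = K`, `s_ε^{ζ+1}(K) = s_ε(s_ε^ζ(K))`, and
`s_ε^ξ(K) = ⋂_{ζ < ξ} s_ε^ζ(K)` for a limit ordinal `ξ`. -/
def derivIter (ε : ℝ) (ξ : Ordinal.{w}) (K : Set (WeakDual 𝕜 X)) : Set (WeakDual 𝕜 X) :=
  Ordinal.limitRecOn (motive := fun _ => Set (WeakDual 𝕜 X)) ξ K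
    (fun _ L => szlenkDeriv ε L) (fun ξ _ L => ⋂ ζ : Set.Iio ξ, L ζ.1 ζ.2)

theorem derivIter_zero (ε : ℝ) (K : Set (WeakDual 𝕜 X)) :
    derivIter ε (0 : Ordinal.{w}) K = K :=
  Ordinal.limitRecOn_zero ..

theorem derivIter_add_one (ε : ℝ) (ζ : Ordinal.{w}) (K : Set (WeakDual 𝕜 X)) :
    derivIter ε (ζ + 1) K = szlenkDeriv ε (derivIter ε ζ K) :=
  Ordinal.limitRecOn_add_one ..

theorem derivIter_limit (ε : ℝ) (ξ : Ordinal.{w}) (hξ : Order.IsSuccLimit ξ)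
    (K : Set (WeakDual 𝕜 X)) :
    derivIter ε ξ K = ⋂ ζ : Set.Iio ξ, derivIter ε ζ.1 K :=
  Ordinal.limitRecOn_limit _ _ _ _ hξ

/-- `Sz(K, ε)`: the least ordinal `ζ` with `s_ε^ζ(K) = ∅`, and `⊤` if there is none. -/
def szlenkAt (K : Set (WeakDual 𝕜 X)) (ε : ℝ) : WithTop Ordinal.{w} :=
  sInf ((fun ζ : Ordinal.{w} => (ζ : WithTop Ordinal.{w})) '' {ζ | derivIter ε ζ K = ∅})

/-- The Szlenk index `Sz(K) = sup_{ε > 0} Sz(K, ε)`. -/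
def szlenk (K : Set (WeakDual 𝕜 X)) : WithTop Ordinal.{w} :=
  ⨆ ε : {ε : ℝ // 0 < ε}, szlenkAt K ε.1

/-- `s_{ε₁}^{ζ} ⋯ s_{εₙ}^{ζ}(K)` for a list `[ε₁, …, εₙ]`; the derivation with `εₙ` is applied
first. -/
def derivList (ζ : Ordinal.{w}) (l : List ℝ) (K : Set (WeakDual 𝕜 X)) : Set (WeakDual 𝕜 X) :=
  l.foldr (fun ε L => derivIter ε ζ L) K

/-- `K` has `M`-`ξ`-`q`-summable Szlenk index. -/
def HasSummableWith (M : ℝ) (ξ : Ordinal.{w}) (q : ℝ) (K : Set (WeakDual 𝕜 X)) : Prop :=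
  ∀ l : List ℝ, (∀ ε ∈ l, 0 ≤ ε) → (derivList (Ordinal.omega0 ^ ξ) l K).Nonempty →
    (l.map fun ε => ε ^ q).sum ≤ M ^ q

/-- `K` has `ξ`-`q`-summable Szlenk index. -/
def HasSummable (ξ : Ordinal.{w}) (q : ℝ) (K : Set (WeakDual 𝕜 X)) : Prop :=
  ∃ M : ℝ, 0 ≤ M ∧ HasSummableWith M ξ q K

/-- `Sz_ξ(K, ε)`: the least natural number `n` with `Sz(K, ε) ≤ ω^ξ · n`. It is only used when
`Sz(K) ≤ ω^(ξ+1)`, in which case such an `n` exists by weak*-compactness. -/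
def szlenkNat (ξ : Ordinal.{w}) (K : Set (WeakDual 𝕜 X)) (ε : ℝ) : ℕ :=
  sInf {n : ℕ | szlenkAt K ε ≤ ((Ordinal.omega0 ^ ξ * (n : Ordinal.{w}) : Ordinal.{w}) :
    WithTop Ordinal.{w})}

open Classical in
/-- The `ξ`-Szlenk power type `p_ξ(K) = limsup_{ε → 0⁺} log Sz_ξ(K, ε) / |log ε|`, a value in
`[0, ∞]`, if `Sz(K) ≤ ω^(ξ+1)`, and `p_ξ(K) = ∞` otherwise. -/
def powerType (ξ : Ordinal.{w}) (K : Set (WeakDual 𝕜 X)) : EReal :=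
  if szlenk K ≤ ((Ordinal.omega0 ^ (ξ + 1) : Ordinal.{w}) : WithTop Ordinal.{w}) then
    limsup (fun ε : ℝ => ((Real.log (szlenkNat ξ K ε) / |Real.log ε| : ℝ) : EReal)) (𝓝[>] 0)
  else ⊤

/-- The weak*-closed absolutely convex hull of `K`. -/
def weakStarAbsCo (K : Set (WeakDual 𝕜 X)) : Set (WeakDual 𝕜 X) :=
  closure (absConvexHull 𝕜 K)

end SzlenkIndex

end

/-! The heart of the matter is a transfer principle (`transfersDeriv`). If `x` survives `s_ε^{ω^ξ}`
of a subset of a closed convex hull, then `(x, ε/2)` lies in the closed convex hull of the pairs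
`(g, b)` for which the generator `g` survives `s_c^{ω^ξ}` for every `c < b`. The parameter is thus
averaged together with the point.

The principle is proved by induction on `ξ`. For one derivation, Hahn-Banach turns failure into an
affine function dominating the local diameters of the generators but lying below `ε/2` at `x`; such
a bound passes to the hull (`eventually_seminorm_sub_le`), a contradiction. To allow iteration, the
principle is stated for sets lying over the original space by a map `π`: the pairs themselves become
generators in `E × (ℕ → ℝ)`, and repeated use handles sequences of parameters
(`TransfersDeriv.seq`). Averaging a long bounded sequence then leads from `ω^ρ` to `ω^(ρ+1)`
(`TransfersDeriv.add_one`), and limits are compactness.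

For (i), a sublevel set of the convex function `∑ b i ^ q`, `q ≥ 1`, that contains the parameter
sequences of the generators contains those of the hull, halved. Disc multiples, which reduce
absolutely convex hulls to convex ones, cost a further factor `4` (`seminormIter_discHull_subset`).

For (ii), `q`-summability gives power type at most `q`, and power type below `q` gives
`q`-summability by counting large parameters, so (i) bounds the power type of the hull for every
exponent above `max (p_ξ(K)) 1`. The lower bound `1` comes from the convexity of the hull
(`mem_seminormIter_mul_nat`). If `Sz(K) ≤ ω^ξ`, the summability constant is `0` and remains `0` for
the hull. -/

noncomputable section

namespace SzlenkIndex

/-! ### Derivations with respect to a seminorm -/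

section Derivation

variable {E : Type*} [AddCommGroup E] [Module ℝ E] [TopologicalSpace E]

/-- The derivation `s_ε` of `G` with the diameter measured by a seminorm `p`. -/
def seminormDeriv (p : Seminorm ℝ E) (ε : ℝ) (G : Set E) : Set E :=
  {x | x ∈ G ∧ (0 < ε → ∀ V ∈ 𝓝 x, ∃ y ∈ V ∩ G, ∃ z ∈ V ∩ G, ε < p (y - z))}

/-- The transfinite iterates of `seminormDeriv`. -/
def seminormIter (p : Seminorm ℝ E) (ε : ℝ) (ξ : Ordinal.{w}) (G : Set E) : Set E :=
  Ordinal.limitRecOn (motive := fun _ => Set E) ξ G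
    (fun _ L => seminormDeriv p ε L) (fun ξ _ L => ⋂ ζ : Set.Iio ξ, L ζ.1 ζ.2)

/-- The set `s_{a (n-1)}^ζ ⋯ s_{a 0}^ζ(G)`. -/
def seminormSeq (p : Seminorm ℝ E) (ζ : Ordinal.{w}) (a : ℕ → ℝ) : ℕ → Set E → Set E
  | 0, G => G
  | n + 1, G => seminormIter p (a n) ζ (seminormSeq p ζ a n G)

variable {p : Seminorm ℝ E} {ε ε' : ℝ} {G H : Set E}

theorem seminormIter_zero (p : Seminorm ℝ E) (ε : ℝ) (G : Set E) :
    seminormIter p ε (0 : Ordinal.{w}) G = G :=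
  Ordinal.limitRecOn_zero ..

theorem seminormIter_add_one (p : Seminorm ℝ E) (ε : ℝ) (ζ : Ordinal.{w}) (G : Set E) :
    seminormIter p ε (ζ + 1) G = seminormDeriv p ε (seminormIter p ε ζ G) :=
  Ordinal.limitRecOn_add_one ..

theorem seminormIter_limit (p : Seminorm ℝ E) (ε : ℝ) {ξ : Ordinal.{w}}
    (hξ : Order.IsSuccLimit ξ) (G : Set E) :
    seminormIter p ε ξ G = ⋂ ζ : Set.Iio ξ, seminormIter p ε ζ.1 G :=
  Ordinal.limitRecOn_limit _ _ _ _ hξ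

theorem seminormIter_one (p : Seminorm ℝ E) (ε : ℝ) (G : Set E) :
    seminormIter p ε (1 : Ordinal.{w}) G = seminormDeriv p ε G := by
  rw [← zero_add (1 : Ordinal.{w}), seminormIter_add_one, seminormIter_zero]

theorem seminormDeriv_subset : seminormDeriv p ε G ⊆ G := fun _ hx => hx.1

theorem seminormDeriv_mono (hGH : G ⊆ H) (hε : ε' ≤ ε) :
    seminormDeriv p ε G ⊆ seminormDeriv p ε' H := by
  rintro x ⟨hx, h⟩
  refine ⟨hGH hx, fun h0 V hV => ?_⟩
  obtain ⟨y, hy, z, hz, hyz⟩ := h (h0.trans_le hε) V hV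
  exact ⟨y, ⟨hy.1, hGH hy.2⟩, z, ⟨hz.1, hGH hz.2⟩, hε.trans_lt hyz⟩

theorem seminormDeriv_of_nonpos (hε : ε ≤ 0) : seminormDeriv p ε G = G :=
  Set.Subset.antisymm seminormDeriv_subset fun _ hx => ⟨hx, fun h => absurd h hε.not_gt⟩

theorem isClosed_seminormDeriv (hG : IsClosed G) : IsClosed (seminormDeriv p ε G) := by
  rw [← closure_subset_iff_isClosed]
  intro x hx
  refine ⟨hG.closure_subset_iff.2 seminormDeriv_subset hx, fun h0 V hV => ?_⟩
  obtain ⟨U, hUV, hU, hxU⟩ := mem_nhds_iff.1 hV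
  obtain ⟨y, hyU, hy⟩ := mem_closure_iff.1 hx U hU hxU
  exact hy.2 h0 V (mem_of_superset (hU.mem_nhds hyU) hUV)

theorem seminormIter_antitone (p : Seminorm ℝ E) (ε : ℝ) (G : Set E) :
    Antitone fun ζ : Ordinal.{w} => seminormIter p ε ζ G := by
  intro ζ ξ hζξ
  induction ξ using Ordinal.limitRecOn with
  | zero => rw [le_antisymm hζξ (zero_le)]
  | add_one ξ ih =>
    rcases hζξ.eq_or_lt with rfl | h
    · exact subset_rfl
    · simp only [seminormIter_add_one]
      exact seminormDeriv_subset.trans (ih (Order.lt_add_one_iff.1 h))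
  | limit ξ hξ ih =>
    rcases hζξ.eq_or_lt with rfl | h
    · exact subset_rfl
    · simp only [seminormIter_limit p ε hξ]
      exact Set.iInter_subset_of_subset ⟨ζ, h⟩ subset_rfl

theorem seminormIter_subset (ζ : Ordinal.{w}) : seminormIter p ε ζ G ⊆ G := by
  have := seminormIter_antitone p ε G (zero_le (a := ζ))
  simpa only [seminormIter_zero] using this

theorem seminormIter_mono (ζ : Ordinal.{w}) (hGH : G ⊆ H) (hε : ε' ≤ ε) :
    seminormIter p ε ζ G ⊆ seminormIter p ε' ζ H := by
  induction ζ using Ordinal.limitRecOn with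
  | zero => simpa only [seminormIter_zero]
  | add_one ζ ih =>
    simp only [seminormIter_add_one]
    exact seminormDeriv_mono ih hε
  | limit ζ hζ ih =>
    simp only [seminormIter_limit p _ hζ]
    exact Set.iInter_mono fun η => ih η.1 η.2

theorem seminormIter_of_nonpos (ζ : Ordinal.{w}) (hε : ε ≤ 0) : seminormIter p ε ζ G = G := by
  induction ζ using Ordinal.limitRecOn with
  | zero => rw [seminormIter_zero]
  | add_one ζ ih => rw [seminormIter_add_one, ih, seminormDeriv_of_nonpos hε]
  | limit ζ hζ ih =>
    rw [seminormIter_limit p _ hζ]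
    have : Nonempty (Set.Iio ζ) := ⟨⟨0, hζ.bot_lt⟩⟩
    rw [Set.iInter_congr fun η : Set.Iio ζ => ih η.1 η.2, Set.iInter_const]

theorem isClosed_seminormIter (ζ : Ordinal.{w}) (hG : IsClosed G) :
    IsClosed (seminormIter p ε ζ G) := by
  induction ζ using Ordinal.limitRecOn with
  | zero => rwa [seminormIter_zero]
  | add_one ζ ih =>
    rw [seminormIter_add_one]
    exact isClosed_seminormDeriv ih
  | limit ζ hζ ih =>
    rw [seminormIter_limit p _ hζ]
    exact isClosed_iInter fun η => ih η.1 η.2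

theorem seminormIter_add (α β : Ordinal.{w}) :
    seminormIter p ε (α + β) G = seminormIter p ε β (seminormIter p ε α G) := by
  induction β using Ordinal.limitRecOn with
  | zero => rw [add_zero, seminormIter_zero]
  | add_one β ih => rw [← add_assoc, seminormIter_add_one, ih, seminormIter_add_one]
  | limit β hβ ih =>
    rw [seminormIter_limit p _ hβ, seminormIter_limit p _ (Ordinal.isSuccLimit_add α hβ)]
    apply Set.Subset.antisymm
    · refine Set.subset_iInter fun η => ?_
      rw [← ih η.1 η.2]
      exact Set.iInter_subset_of_subset ⟨α + η.1, add_lt_add_right η.2 α⟩ subset_rfl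
    · refine Set.subset_iInter fun η => ?_
      rcases lt_or_ge η.1 α with h | h
      · refine Set.iInter_subset_of_subset ⟨0, hβ.bot_lt⟩ ?_
        rw [seminormIter_zero]
        exact seminormIter_antitone p ε G h.le
      · have hlt : η.1 - α < β := by
          have h2 : η.1 < α + β := η.2
          rw [← Ordinal.add_sub_cancel_of_le h] at h2
          exact lt_of_add_lt_add_left h2
        refine Set.iInter_subset_of_subset ⟨η.1 - α, hlt⟩ ?_
        rw [← ih _ hlt, Ordinal.add_sub_cancel_of_le h]

theorem seminormSeq_subset (ζ : Ordinal.{w}) (a : ℕ → ℝ) (n : ℕ) : seminormSeq p ζ a n G ⊆ G := by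
  induction n with
  | zero => exact subset_rfl
  | succ n ih => exact (seminormIter_subset ζ).trans ih

theorem seminormSeq_mono (ζ : Ordinal.{w}) {a b : ℕ → ℝ} (n : ℕ) (hGH : G ⊆ H)
    (hab : ∀ i < n, b i ≤ a i) : seminormSeq p ζ a n G ⊆ seminormSeq p ζ b n H := by
  induction n with
  | zero => exact hGH
  | succ n ih =>
    exact seminormIter_mono ζ (ih fun i hi => hab i (hi.trans (Nat.lt_succ_self n)))
      (hab n (Nat.lt_succ_self n))

theorem isClosed_seminormSeq (ζ : Ordinal.{w}) (a : ℕ → ℝ) (n : ℕ) (hG : IsClosed G) :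
    IsClosed (seminormSeq p ζ a n G) := by
  induction n with
  | zero => exact hG
  | succ n ih => exact isClosed_seminormIter ζ ih

theorem seminormSeq_const (ζ : Ordinal.{w}) (n : ℕ) :
    seminormSeq p ζ (fun _ => ε) n G = seminormIter p ε (ζ * n) G := by
  induction n with
  | zero => simp [seminormSeq, seminormIter_zero]
  | succ n ih =>
    rw [seminormSeq, ih, ← seminormIter_add, Nat.cast_succ, mul_add_one]

/-- Derivations by small parameters may be dropped. -/
theorem seminormSeq_subset_iter_card (ζ : Ordinal.{w}) (a : ℕ → ℝ) (c : ℝ) (n : ℕ) :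
    seminormSeq p ζ a n G ⊆
      seminormIter p c (ζ * (((Finset.range n).filter fun i => c ≤ a i).card : Ordinal.{w})) G := by
  induction n with
  | zero => simp [seminormSeq, seminormIter_zero]
  | succ n ih =>
    rw [Finset.range_add_one, Finset.filter_insert]
    split_ifs with h
    · rw [Finset.card_insert_of_notMem (by simp), Nat.cast_succ, mul_add_one, seminormIter_add]
      exact seminormIter_mono ζ ih h
    · exact (seminormIter_subset ζ).trans ih

theorem seminormIter_subset_seminormDeriv {ζ : Ordinal.{w}} (hζ : 1 ≤ ζ) :
    seminormIter p ε ζ G ⊆ seminormDeriv p ε G := by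
  have h := seminormIter_antitone p ε G hζ
  simpa only [seminormIter_one] using h

end Derivation

/-! ### Lifting limits through continuous images of compact sets -/

section Compactness

/-- Along a continuous map on a compact set, convergent ultrafilters lift to convergent ones. -/
theorem exists_ultrafilter_lift {T E : Type*} [TopologicalSpace T] [TopologicalSpace E] [T2Space E]
    {S : Set T} (hS : IsCompact S) {Ψ : T → E} (hΨ : Continuous Ψ) {U : Ultrafilter E} {q : E}
    (hU : ↑U ≤ 𝓝 q) (hSU : Ψ '' S ∈ U) :
    ∃ V : Ultrafilter T, ∃ τ ∈ S, ↑V ≤ 𝓝[S] τ ∧ V.map Ψ = U ∧ Ψ τ = q := by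
  have hne : (comap Ψ (U : Filter E) ⊓ 𝓟 S).NeBot := by
    rw [inf_principal_neBot_iff]
    rintro A ⟨B, hB, hBA⟩
    obtain ⟨_, ⟨s, hs, rfl⟩, hsB⟩ := U.nonempty_of_mem (inter_mem hSU hB)
    exact ⟨s, hBA hsB, hs⟩
  obtain ⟨V, hV⟩ := Ultrafilter.exists_le (comap Ψ (U : Filter E) ⊓ 𝓟 S)
  have hVS : ↑V ≤ 𝓟 S := hV.trans inf_le_right
  obtain ⟨τ, hτ, hVτ⟩ := hS.ultrafilter_le_nhds V hVS
  have hmap : V.map Ψ = U := by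
    refine Ultrafilter.coe_le_coe.1 ?_
    rw [Ultrafilter.coe_map, map_le_iff_le_comap]
    exact hV.trans inf_le_left
  refine ⟨V, τ, hτ, le_inf hVτ hVS, hmap, ?_⟩
  refine tendsto_nhds_unique (f := Ψ) (l := (V : Filter T)) ((hΨ.tendsto τ).mono_left hVτ) ?_
  rw [Tendsto, ← Ultrafilter.coe_map, hmap]
  exact hU

theorem exists_ultrafilter_of_frequently {E : Type*} {l : Filter E} {P : E → Prop}
    (h : ∃ᶠ x in l, P x) : ∃ U : Ultrafilter E, ↑U ≤ l ∧ ∀ᶠ x in (U : Filter E), P x := by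
  have := frequently_iff_neBot.1 h
  obtain ⟨U, hU⟩ := Ultrafilter.exists_le (l ⊓ 𝓟 {x | P x})
  exact ⟨U, hU.trans inf_le_left, le_principal_iff.1 (hU.trans inf_le_right)⟩

/-- The factor `2` of the transfer principle arises here: two points more than `ε` apart cannot both
be within `ε / 2` of `x`. An ultrafilter of far points near `x` is lifted to `S`, and its limit
upstairs is the required preimage. -/
theorem exists_frequently_of_mem_seminormDeriv_image {E T : Type*} [AddCommGroup E]
    [Module ℝ E] [TopologicalSpace E] [T2Space E] [TopologicalSpace T] {p : Seminorm ℝ E}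
    {S : Set T} (hS : IsCompact S) {Ψ : T → E} (hΨ : Continuous Ψ) {ε : ℝ}
    (hε : 0 < ε) {x : E} (hx : x ∈ seminormDeriv p ε (Ψ '' S)) :
    ∃ τ ∈ S, Ψ τ = x ∧ ∃ᶠ τ' in 𝓝[S] τ, ε / 2 < p (Ψ τ' - Ψ τ) := by
  have hfreq : ∃ᶠ y in 𝓝 x, y ∈ Ψ '' S ∧ ε / 2 < p (y - x) := by
    refine frequently_iff.2 fun {V} hV => ?_
    obtain ⟨y, hy, z, hz, hyz⟩ := hx.2 hε V hV
    have h1 := map_add_le_add p (y - x) (x - z)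
    rw [sub_add_sub_cancel, map_sub_rev p x z] at h1
    rcases lt_or_ge (ε / 2) (p (y - x)) with h | h
    · exact ⟨y, hy.1, hy.2, h⟩
    · exact ⟨z, hz.1, hz.2, by linarith⟩
  obtain ⟨U, hU, hUP⟩ := exists_ultrafilter_of_frequently hfreq
  obtain ⟨V, τ, hτ, hV, rfl, rfl⟩ := exists_ultrafilter_lift hS hΨ hU (hUP.mono fun _ h => h.1)
  have hUP' : ∀ᶠ τ' in (V : Filter T), ε / 2 < p (Ψ τ' - Ψ τ) := hUP.mono fun _ h => h.2
  exact ⟨τ, hτ, rfl, hUP'.frequently.filter_mono hV⟩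

end Compactness

/-! ### Closed convex hulls: oscillation and decreasing intersections -/

section Hull

variable {E F : Type*} [AddCommGroup E] [Module ℝ E] [TopologicalSpace E]
  [AddCommGroup F] [Module ℝ F] [TopologicalSpace F]

theorem closure_convexHull_subset {G C : Set E} (h : G ⊆ C) (hC : Convex ℝ C) (hC' : IsClosed C) :
    closure (convexHull ℝ G) ⊆ C :=
  closure_minimal (convexHull_min h hC) hC'

theorem subset_closure_convexHull (G : Set E) : G ⊆ closure (convexHull ℝ G) :=
  (subset_convexHull ℝ G).trans subset_closure

theorem closure_convexHull_mono {G H : Set E} (h : G ⊆ H) :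
    closure (convexHull ℝ G) ⊆ closure (convexHull ℝ H) :=
  closure_mono (convexHull_mono h)

theorem convex_seminorm_sub_le {E : Type*} [AddCommGroup E] [Module ℝ E] (p : Seminorm ℝ E)
    (z : E) (d : ℝ) : Convex ℝ {y | p (y - z) ≤ d} := by
  have : {y | p (y - z) ≤ d} = p.closedBall z d := by ext; simp [Seminorm.mem_closedBall]
  rw [this]
  exact p.convex_closedBall z d

theorem map_mem_closure_convexHull [IsTopologicalAddGroup F] [ContinuousSMul ℝ F]
    (T : E →L[ℝ] F) {G : Set E} {H : Set F}
    (hT : ∀ g ∈ G, T g ∈ H) {q : E} (hq : q ∈ closure (convexHull ℝ G)) :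
    T q ∈ closure (convexHull ℝ H) := by
  have : closure (convexHull ℝ G) ⊆ T ⁻¹' closure (convexHull ℝ H) :=
    closure_convexHull_subset (fun g hg => subset_closure_convexHull H (hT g hg))
      ((convex_convexHull ℝ H).closure.is_linear_preimage T.toLinearMap.isLinear)
      (isClosed_closure.preimage T.continuous)
  exact this hq

variable [IsTopologicalAddGroup E]

theorem seminorm_sub_le_of_mem_closure_convexHull {p : Seminorm ℝ E}
    (hp : ∀ r, IsClosed {x | p x ≤ r}) {G : Set E} {d : ℝ} (h : ∀ y ∈ G, ∀ z ∈ G, p (y - z) ≤ d) :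
    ∀ y ∈ closure (convexHull ℝ G), ∀ z ∈ closure (convexHull ℝ G), p (y - z) ≤ d := by
  have conv (z : E) := convex_seminorm_sub_le p z d
  have clos (z : E) : IsClosed {y | p (y - z) ≤ d} :=
    (hp d).preimage (f := fun y => y - z) (by fun_prop)
  have h1 : ∀ z ∈ G, closure (convexHull ℝ G) ⊆ {y | p (y - z) ≤ d} := fun z hz =>
    closure_convexHull_subset (fun y hy => h y hy z hz) (conv z) (clos z)
  intro y hy z hz
  refine closure_convexHull_subset (fun y' hy' => ?_) (conv z) (clos z) hy
  have := h1 y' hy' hz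
  rwa [Set.mem_ofPred_eq, map_sub_rev p] at this

variable [ContinuousSMul ℝ E]

theorem mem_closure_convexHull_union {A B : Set E} (hA : IsCompact (closure (convexHull ℝ A)))
    (hB : IsCompact (closure (convexHull ℝ B))) [T2Space E] (hA' : A.Nonempty) (hB' : B.Nonempty) :
    closure (convexHull ℝ (A ∪ B)) ⊆ (fun τ : ℝ × E × E => (1 - τ.1) • τ.2.1 + τ.1 • τ.2.2) ''
      (Set.Icc 0 1 ×ˢ closure (convexHull ℝ A) ×ˢ closure (convexHull ℝ B)) := by
  refine closure_minimal ?_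
    (((isCompact_Icc.prod (hA.prod hB)).image (by fun_prop)).isClosed)
  rw [convexHull_union hA' hB']
  intro x hx
  obtain ⟨a, ha, b, hb, hx⟩ := mem_convexJoin.1 hx
  rw [segment_eq_image] at hx
  obtain ⟨θ, hθ, rfl⟩ := hx
  exact ⟨(θ, a, b), ⟨hθ, subset_closure ha, subset_closure hb⟩, rfl⟩

/-- If `G` is locally of `p`-diameter at most the affine function `α - f`, then the `p`-oscillation
of the closed convex hull of `G` at each of its points `q` is controlled by `α - f q`. -/
theorem eventually_seminorm_sub_le [T2Space E] {p : Seminorm ℝ E}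
    (hp : ∀ r, IsClosed {x | p x ≤ r}) {G : Set E} (hG : IsClosed G)
    (hC : IsCompact (closure (convexHull ℝ G))) {R : ℝ} (hR : ∀ y ∈ G, ∀ z ∈ G, p (y - z) ≤ R)
    (f : E →L[ℝ] ℝ) (α : ℝ)
    (hloc : ∀ g ∈ G, ∃ t ∈ 𝓝[G] g, ∃ d, (∀ y ∈ t, ∀ z ∈ t, p (y - z) ≤ d) ∧
      ∀ y ∈ t, d ≤ α - f y) :
    ∀ q ∈ closure (convexHull ℝ G), ∀ η > 0, ∀ᶠ q' in 𝓝[closure (convexHull ℝ G)] q,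
      p (q' - q) ≤ α - f q + η := by
  have hGc : IsCompact G := hC.of_isClosed_subset hG (subset_closure_convexHull G)
  have hR' := seminorm_sub_le_of_mem_closure_convexHull hp hR
  -- Compactness reduces the claim to small pieces, where the diameter bound passes to the hull, and
  -- to unions of two pieces.
  have key := hGc.induction_on (p := fun s : Set E => ∀ q ∈ closure (convexHull ℝ (s ∩ G)), ∀ η > 0,
    ∀ᶠ q' in 𝓝[closure (convexHull ℝ (s ∩ G))] q, p (q' - q) ≤ α - f q + η) ?_ ?_ ?_ ?_
  · rwa [Set.inter_self] at key
  · simp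
  · intro s t hst ht q hq η hη
    have hsub := closure_convexHull_mono (Set.inter_subset_inter_left G hst)
    exact (ht q (hsub hq) η hη).filter_mono (nhdsWithin_mono q hsub)
  · intro s t hs ht
    rw [Set.union_inter_distrib_right]
    rcases (s ∩ G).eq_empty_or_nonempty with h1 | h1
    · rwa [h1, Set.empty_union]
    rcases (t ∩ G).eq_empty_or_nonempty with h2 | h2
    · rwa [h2, Set.union_empty]
    have hsG := closure_convexHull_mono (Set.inter_subset_right (s := s) (t := G))
    have htG := closure_convexHull_mono (Set.inter_subset_right (s := t) (t := G))
    have hcs := hC.of_isClosed_subset isClosed_closure hsG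
    have hct := hC.of_isClosed_subset isClosed_closure htG
    have hun := mem_closure_convexHull_union hcs hct h1 h2
    intro q hq η hη
    by_contra hcon
    obtain ⟨U, hU, hUη⟩ := exists_ultrafilter_of_frequently (not_eventually.1 hcon)
    -- Bad points near `q` are written as `(1 - θ') y' + θ' z'`; along the lifted ultrafilter `θ'`,
    -- `y'`, `z'` converge, which yields a matching decomposition of `q`.
    obtain ⟨V, ⟨θ, y, z⟩, ⟨hθ, hy, hz⟩, hV, rfl, rfl⟩ := exists_ultrafilter_lift
      (isCompact_Icc.prod (hcs.prod hct)) (by fun_prop) (hU.trans nhdsWithin_le_nhds)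
      (mem_of_superset (hU self_mem_nhdsWithin) hun)
    simp only at hy hz hθ
    have hVS := hV.trans inf_le_right
    have t1 : Tendsto (fun τ : ℝ × E × E => τ.2.1) V (𝓝[closure (convexHull ℝ (s ∩ G))] y) := by
      refine tendsto_nhdsWithin_iff.2 ⟨?_, ?_⟩
      · exact (Continuous.tendsto (by fun_prop) (θ, y, z)).mono_left (hV.trans nhdsWithin_le_nhds)
      · exact Filter.Eventually.mono (le_principal_iff.1 hVS) fun τ hτ => hτ.2.1
    have t2 : Tendsto (fun τ : ℝ × E × E => τ.2.2) V (𝓝[closure (convexHull ℝ (t ∩ G))] z) := by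
      refine tendsto_nhdsWithin_iff.2 ⟨?_, ?_⟩
      · exact (Continuous.tendsto (by fun_prop) (θ, y, z)).mono_left (hV.trans nhdsWithin_le_nhds)
      · exact Filter.Eventually.mono (le_principal_iff.1 hVS) fun τ hτ => hτ.2.2
    have t3 : Tendsto (fun τ : ℝ × E × E => |τ.1 - θ| * R) V (𝓝 0) := by
      have : Tendsto (fun τ : ℝ × E × E => |τ.1 - θ| * R) (𝓝 (θ, y, z)) (𝓝 (|θ - θ| * R)) :=
        Continuous.tendsto (by fun_prop) (θ, y, z)
      rw [sub_self, abs_zero, zero_mul] at this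
      exact this.mono_left (hV.trans nhdsWithin_le_nhds)
    have hη2 : 0 < η / 2 := half_pos hη
    have e1 := t1.eventually (hs y hy (η / 2) hη2)
    have e2 := t2.eventually (ht z hz (η / 2) hη2)
    have e3 := t3.eventually (gt_mem_nhds hη2)
    have e4 := (le_principal_iff.1 hVS)
    obtain ⟨⟨θ', y', z'⟩, h1', h2', h3', h4', h5'⟩ :=
      (e1.and (e2.and (e3.and (Filter.Eventually.and e4 hUη)))).exists
    simp only at h1' h2' h3' h5'
    refine h5' ?_
    -- The first two terms average the bounds at `y` and `z`, which is exact because `α - f` is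
    -- affine; the last is at most `|θ' - θ| * R`, hence negligible.
    have hdec : (1 - θ') • y' + θ' • z' - ((1 - θ) • y + θ • z) =
        ((1 - θ) • (y' - y) + θ • (z' - z)) + (θ' - θ) • (z' - y') := by module
    rw [hdec]
    have b1 := map_add_le_add p ((1 - θ) • (y' - y) + θ • (z' - z)) ((θ' - θ) • (z' - y'))
    have b2 := map_add_le_add p ((1 - θ) • (y' - y)) (θ • (z' - z))
    simp only [map_smul_eq_mul, Real.norm_eq_abs, abs_of_nonneg hθ.1,
      abs_of_nonneg (sub_nonneg.2 hθ.2)] at b1 b2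
    have b3 : |θ' - θ| * p (z' - y') ≤ |θ' - θ| * R :=
      mul_le_mul_of_nonneg_left (hR' z' (htG h4'.2.2) y' (hsG h4'.2.1)) (abs_nonneg _)
    have b4 := mul_le_mul_of_nonneg_left h1' (sub_nonneg.2 hθ.2)
    have b5 := mul_le_mul_of_nonneg_left h2' hθ.1
    simp only [map_add, map_smul, smul_eq_mul]
    nlinarith
  · intro g hg
    obtain ⟨t, ht, d, h1, h2⟩ := hloc g hg
    refine ⟨t, ht, fun q hq η hη => ?_⟩
    have hd := seminorm_sub_le_of_mem_closure_convexHull (G := t ∩ G) hp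
      (fun y hy z hz => h1 y hy.1 z hz.1)
    have hdq : d ≤ α - f q := by
      have : closure (convexHull ℝ (t ∩ G)) ⊆ {y | f y ≤ α - d} :=
        closure_convexHull_subset (fun y hy => by have := h2 y hy.1; simp; linarith)
          (convex_halfSpace_le f.toLinearMap.isLinear _)
          (isClosed_le f.continuous continuous_const)
      have := this hq
      simp only [Set.mem_ofPred_eq] at this
      linarith
    filter_upwards [self_mem_nhdsWithin] with q' hq'
    linarith [hd q' hq' q hq]

/-- Closed convex hulls commute with decreasing intersections of compact sets: a closed half-space
meeting every `D i` meets their intersection, so no functional can separate. Compactness of `F`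
first fixes one `q` for all `i`. -/
theorem exists_mem_closure_convexHull_iInter [LocallyConvexSpace ℝ E] [T2Space E]
    {ι : Type*} [Nonempty ι] [Preorder ι] [IsDirectedOrder ι] {F : Set E} (hF : IsCompact F)
    {D : ι → Set (E × ℝ)} (hD : Antitone D) (hc : ∀ i, IsCompact (D i))
    {β : ℝ} (h : ∀ i, ∃ q ∈ F, (q, β) ∈ closure (convexHull ℝ (D i))) :
    ∃ q ∈ F, (q, β) ∈ closure (convexHull ℝ (⋂ i, D i)) := by
  let K : ι → Set E := fun i => F ∩ {q | (q, β) ∈ closure (convexHull ℝ (D i))}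
  have hclosed i : IsClosed {q : E | (q, β) ∈ closure (convexHull ℝ (D i))} :=
    isClosed_closure.preimage (f := fun q : E => (q, β)) (by fun_prop)
  have hK i : IsCompact (K i) := hF.inter_right (hclosed i)
  have hanti : Antitone K := fun i j hij =>
    Set.inter_subset_inter_right F fun q hq => closure_convexHull_mono (hD hij) hq
  obtain ⟨q, hq⟩ := IsCompact.nonempty_iInter_of_directed_nonempty_isCompact_isClosed K
    (directed_of_isDirected_le hanti) (fun i => (h i).imp fun q hq => ⟨hq.1, hq.2⟩) hK
    fun i => (hK i).isClosed
  rw [Set.mem_iInter] at hq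
  refine ⟨q, (hq (Classical.arbitrary ι)).1, ?_⟩
  by_contra hcon
  obtain ⟨f, s, hs, hsq⟩ := geometric_hahn_banach_closed_point
    (convex_convexHull ℝ (⋂ i, D i)).closure isClosed_closure hcon
  have hne : ∀ i, (D i ∩ {x | s ≤ f x}).Nonempty := by
    intro i
    by_contra hemp
    have hsub : closure (convexHull ℝ (D i)) ⊆ {x | f x ≤ s} :=
      closure_convexHull_subset (fun x hx => by
        by_contra hx'
        exact hemp ⟨x, hx, le_of_lt (by simpa using hx')⟩)
        (convex_halfSpace_le f.toLinearMap.isLinear _)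
        (isClosed_le f.continuous continuous_const)
    exact absurd (hsub (hq i).2) (not_le.2 hsq)
  have hcl : IsClosed {x | s ≤ f x} := isClosed_le continuous_const f.continuous
  obtain ⟨x, hx⟩ := IsCompact.nonempty_iInter_of_directed_nonempty_isCompact_isClosed
    (fun i => D i ∩ {x | s ≤ f x})
    (directed_of_isDirected_le fun i j hij => Set.inter_subset_inter_left _ (hD hij)) hne
    (fun i => (hc i).inter_right hcl) fun i => ((hc i).inter_right hcl).isClosed
  rw [Set.mem_iInter] at hx
  refine absurd (hs x (subset_closure_convexHull _ (Set.mem_iInter.2 fun i => (hx i).1))) ?_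
  exact not_lt.2 (hx (Classical.arbitrary ι)).2

end Hull

/-! ### The transfer principle: base case and limit case -/

section Step

/-- The points `(g, b)` with `g ∈ s_c^{ω^ξ}(G)` for all `c < b`, where `0 ≤ b ≤ R`. -/
def derivGraph {E : Type*} [AddCommGroup E] [Module ℝ E] [TopologicalSpace E] (p : Seminorm ℝ E)
    (ξ : Ordinal.{w}) (R : ℝ) (G : Set E) : Set (E × ℝ) :=
  {x | x.1 ∈ G ∧ 0 ≤ x.2 ∧ x.2 ≤ R ∧ ∀ c < x.2, x.1 ∈ seminormIter p c (Ordinal.omega0 ^ ξ) G}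

/-- The set of the `(x, b)` such that `x` survives `s_c^ζ` for every `c < b - δ` is closed. -/
theorem isClosed_setOf_forall_lt_mem_seminormIter {E : Type*} [AddCommGroup E] [Module ℝ E]
    [TopologicalSpace E] {p : Seminorm ℝ E} (ζ : Ordinal.{w}) (δ R : ℝ) {G : Set E}
    (hG : IsClosed G) :
    IsClosed {x : E × ℝ | x.1 ∈ G ∧ 0 ≤ x.2 ∧ x.2 ≤ R ∧
      ∀ c < x.2 - δ, x.1 ∈ seminormIter p c ζ G} := by
  refine (hG.preimage continuous_fst).inter ((isClosed_le continuous_const continuous_snd).inter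
    ((isClosed_le continuous_snd continuous_const).inter ?_))
  have : {x : E × ℝ | ∀ c < x.2 - δ, x.1 ∈ seminormIter p c ζ G} =
      ⋂ c : ℝ, ({x | x.2 - δ ≤ c} ∪ {x | x.1 ∈ seminormIter p c ζ G}) := by
    ext x
    simp only [Set.mem_iInter, Set.mem_union, Set.mem_ofPred_eq]
    exact forall_congr' fun c => by rw [← not_lt, imp_iff_not_or]
  change IsClosed {x : E × ℝ | ∀ c < x.2 - δ, x.1 ∈ seminormIter p c ζ G}
  rw [this]
  exact isClosed_iInter fun c => (isClosed_le (by fun_prop) continuous_const).union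
    ((isClosed_seminormIter ζ hG).preimage continuous_fst)

/-- The transfer of `s_ε^{ω^ξ}` from a subset of a closed convex hull to the generating set. -/
def TransfersDeriv {E₀ : Type v} [AddCommGroup E₀] [Module ℝ E₀] [TopologicalSpace E₀]
    (p : Seminorm ℝ E₀) (ξ : Ordinal.{w}) : Prop :=
  ∀ (E : Type v) [AddCommGroup E] [Module ℝ E] [TopologicalSpace E] [IsTopologicalAddGroup E]
    [ContinuousSMul ℝ E] [LocallyConvexSpace ℝ E] [T2Space E] (π : E →L[ℝ] E₀) (G Q : Set E)
    (R ε : ℝ), IsClosed G → IsCompact (closure (convexHull ℝ G)) →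
    (∀ y ∈ G, ∀ z ∈ G, p.comp π.toLinearMap (y - z) ≤ R) → IsClosed Q →
    Q ⊆ closure (convexHull ℝ G) → 0 ≤ ε →
    ∀ x ∈ seminormIter p ε (Ordinal.omega0 ^ ξ) (π '' Q), ∃ q ∈ Q, π q = x ∧
      (q, ε / 2) ∈ closure (convexHull ℝ (derivGraph (p.comp π.toLinearMap) ξ R G))

variable {E₀ : Type v} [AddCommGroup E₀] [Module ℝ E₀] [TopologicalSpace E₀]
  [T2Space E₀] {p : Seminorm ℝ E₀}

/-- A hyperplane separating `(q, ε / 2)` from the hull is the graph of an affine function `α - f`;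
it bounds the local diameters on `G`, hence the oscillation of the hull at `q`, by less than `ε /
2`. -/
theorem transfersDeriv_zero (hp : ∀ r, IsClosed {x | p x ≤ r}) :
    TransfersDeriv p (0 : Ordinal.{w}) := by
  intro E _ _ _ _ _ _ _ π G Q R ε hG hC hR hQ hQC hε x hx
  rw [Ordinal.opow_zero, seminormIter_one] at hx
  have hzero : ∀ g ∈ G, (g, (0 : ℝ)) ∈ derivGraph (p.comp π.toLinearMap) (0 : Ordinal.{w}) R G := by
    intro g hg
    refine ⟨hg, le_rfl, (apply_nonneg _ _).trans (hR g hg g hg), fun c hc => ?_⟩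
    rwa [seminormIter_of_nonpos _ hc.le]
  have hzero' : ∀ q ∈ Q, (q, (0 : ℝ)) ∈ closure (convexHull ℝ
      (derivGraph (p.comp π.toLinearMap) (0 : Ordinal.{w}) R G)) := fun q hq =>
    map_mem_closure_convexHull (ContinuousLinearMap.inl ℝ E ℝ) hzero (hQC hq)
  rcases hε.eq_or_lt with rfl | hε
  · obtain ⟨q, hq, rfl⟩ := seminormDeriv_subset hx
    refine ⟨q, hq, rfl, ?_⟩
    rw [zero_div]
    exact hzero' q hq
  obtain ⟨q, hq, rfl, hfreq⟩ := exists_frequently_of_mem_seminormDeriv_image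
    (hC.of_isClosed_subset hQ hQC) π.continuous hε hx
  refine ⟨q, hq, rfl, ?_⟩
  by_contra hcon
  obtain ⟨F, s, hs, hsq⟩ := geometric_hahn_banach_closed_point
    (convex_convexHull ℝ _).closure isClosed_closure hcon
  have hF : ∀ (e : E) (b : ℝ), F (e, b) = F (e, 0) + b * F (0, 1) := by
    intro e b
    rw [← smul_eq_mul, ← map_smul, ← map_add]
    simp
  set σ := F (0, 1) with hσ
  -- The hyperplane is not vertical: `(q, 0)` lies in the hull and `(q, ε / 2)` beyond the
  -- hyperplane.
  have hσ0 : 0 < σ := by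
    have h1 := hs _ (hzero' q hq)
    rw [hF] at hsq
    by_contra h
    nlinarith [mul_nonneg hε.le (sub_nonneg.2 (not_lt.1 h))]
  set f : E →L[ℝ] ℝ := σ⁻¹ • F.comp (ContinuousLinearMap.inl ℝ E ℝ) with hf
  have hfe : ∀ e, f e = σ⁻¹ * F (e, 0) := fun e => rfl
  set α := σ⁻¹ * s with hα
  have hgraph : ∀ e b, (e, b) ∈ derivGraph (p.comp π.toLinearMap) (0 : Ordinal.{w}) R G →
      b < α - f e := by
    intro e b heb
    have h1 := hs _ (subset_closure_convexHull _ heb)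
    rw [hF] at h1
    rw [hfe, hα, ← mul_sub, ← div_eq_inv_mul, lt_div_iff₀ hσ0]
    linarith
  have hqlt : α - f q < ε / 2 := by
    rw [hF] at hsq
    rw [hfe, hα, ← mul_sub, ← div_eq_inv_mul, div_lt_iff₀ hσ0]
    linarith
  -- Three losses of `κ` occur: in the local diameter, in the variation of `f`, and in the
  -- oscillation estimate. A quarter of the gap leaves room.
  set κ := (ε / 2 - (α - f q)) / 4 with hκ
  have hκ0 : 0 < κ := by rw [hκ]; linarith
  have hev := eventually_seminorm_sub_le (p := p.comp π.toLinearMap)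
    (fun r => (hp r).preimage π.continuous) hG hC hR f (α + 2 * κ) (fun g hg => ?_) q (hQC hq) κ hκ0
  · refine hfreq ((hev.filter_mono (nhdsWithin_mono q hQC)).mono fun q' hq' => ?_)
    rw [Seminorm.comp_apply, ContinuousLinearMap.coe_coe, map_sub] at hq'
    rw [not_lt]
    linarith
  · have hnhds : {y | f y < f g + κ} ∈ 𝓝[G] g :=
      nhdsWithin_le_nhds ((isOpen_lt f.continuous continuous_const).mem_nhds (by simp [hκ0]))
    have hpos : 0 < α - f g := hgraph g 0 (hzero g hg)
    have : ∃ t ∈ 𝓝[G] g, ∀ y ∈ t, ∀ z ∈ t, p.comp π.toLinearMap (y - z) ≤ α - f g + κ := by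
      -- Heights in the graph are capped at `R`; above the cap the global diameter bound suffices.
      by_cases hd : R ≤ α - f g + κ
      · exact ⟨G, self_mem_nhdsWithin, fun y hy z hz => (hR y hy z hz).trans hd⟩
      have hnot : g ∉ seminormDeriv (p.comp π.toLinearMap) (α - f g + κ) G := by
        intro hmem
        have := hgraph g (α - f g + κ) ⟨hg, by positivity, (not_le.1 hd).le, fun c hc => ?_⟩
        · linarith
        · rw [Ordinal.opow_zero, seminormIter_one]
          exact seminormDeriv_mono subset_rfl hc.le hmem
      have : ∃ V ∈ 𝓝 g, ∀ y ∈ V ∩ G, ∀ z ∈ V ∩ G, p.comp π.toLinearMap (y - z) ≤ α - f g + κ := by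
        by_contra! h
        exact hnot ⟨hg, fun _ => h⟩
      obtain ⟨V, hV, h⟩ := this
      exact ⟨V ∩ G, Set.inter_comm G V ▸ inter_mem_nhdsWithin G hV, h⟩
    obtain ⟨t, ht, h⟩ := this
    refine ⟨t ∩ {y | f y < f g + κ}, inter_mem ht hnhds, α - f g + κ,
      fun y hy z hz => h y hy.1 z hz.1, fun y hy => ?_⟩
    have : f y < f g + κ := hy.2
    linarith

/-- The powers `ω^ρ`, `ρ < ξ`, are cofinal in `ω^ξ`, so the graph for `ξ` contains the decreasing
intersection of the compact graphs for `ρ`, and the hull of that intersection is controlled by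
compactness. -/
theorem transfersDeriv_limit {ξ : Ordinal.{w}} (hξ : Order.IsSuccLimit ξ)
    (h : ∀ ρ < ξ, TransfersDeriv p ρ) : TransfersDeriv p ξ := by
  intro E _ _ _ _ _ _ _ π G Q R ε hG hC hR hQ hQC hε x hx
  have hGc : IsCompact G := hC.of_isClosed_subset hG (subset_closure_convexHull G)
  have : Nonempty (Set.Iio ξ) := ⟨⟨0, hξ.bot_lt⟩⟩
  have hpow : ∀ ρ : Set.Iio ξ, (Ordinal.omega0 ^ ρ.1 : Ordinal.{w}) ≤ Ordinal.omega0 ^ ξ := fun ρ =>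
    Ordinal.opow_le_opow_right Ordinal.omega0_pos (le_of_lt ρ.2)
  obtain ⟨q, hq, hmem⟩ := exists_mem_closure_convexHull_iInter (F := Q ∩ π ⁻¹' {x})
    (D := fun ρ : Set.Iio ξ => derivGraph (p.comp π.toLinearMap) ρ.1 R G) (β := ε / 2)
    ((hC.of_isClosed_subset hQ hQC).inter_right (isClosed_singleton.preimage π.continuous))
    (fun ρ σ hρσ y hy => ⟨hy.1, hy.2.1, hy.2.2.1, fun c hc => seminormIter_antitone _ _ _
      (Ordinal.opow_le_opow_right Ordinal.omega0_pos hρσ) (hy.2.2.2 c hc)⟩)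
    (fun ρ => (hGc.prod (isCompact_Icc (a := 0) (b := R))).of_isClosed_subset
      (by simpa only [sub_zero, derivGraph] using
        isClosed_setOf_forall_lt_mem_seminormIter (p := p.comp π.toLinearMap) (Ordinal.omega0 ^ ρ.1) 0 R hG)
      fun y hy => ⟨hy.1, hy.2.1, hy.2.2.1⟩)
    (fun ρ => by
      obtain ⟨q, hq, hqx, hmem⟩ := h ρ.1 ρ.2 E π G Q R ε hG hC hR hQ hQC hε x
        (seminormIter_antitone _ _ _ (hpow ρ) hx)
      exact ⟨q, ⟨hq, hqx⟩, hmem⟩)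
  refine ⟨q, hq.1, hq.2, closure_convexHull_mono (fun y hy => ?_) hmem⟩
  rw [Set.mem_iInter] at hy
  have hy0 := hy (Classical.arbitrary _)
  refine ⟨hy0.1, hy0.2.1, hy0.2.2.1, fun c hc => ?_⟩
  rw [seminormIter_limit _ _ (Ordinal.isSuccLimit_opow Ordinal.one_lt_omega0 hξ), Set.mem_iInter]
  rintro ⟨ζ, hζ⟩
  obtain ⟨ρ, hρ, hζρ⟩ := (Ordinal.lt_opow_of_isSuccLimit Ordinal.omega0_ne_zero hξ).1 hζ
  exact seminormIter_antitone _ _ _ hζρ.le ((hy ⟨ρ, hρ⟩).2.2.2 c hc)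

end Step

/-! ### Graphs of survival for sequences of parameters -/

section Sequences

variable {E : Type*} [AddCommGroup E] [Module ℝ E] [TopologicalSpace E]

/-- The points `(g, a)` with `g ∈ s_{c (n-1)}^{ω^ξ} ⋯ s_{c 0}^{ω^ξ}(G)` whenever `c i < a i` for all
`i < n`, where `0 ≤ a i ≤ R`, and `a i = 0` for `i ≥ n`. -/
def derivSeqGraph (p : Seminorm ℝ E) (ξ : Ordinal.{w}) (R : ℝ) (G : Set E) (n : ℕ) :
    Set (E × (ℕ → ℝ)) :=
  {x | x.1 ∈ G ∧ (∀ i, x.2 i ∈ Set.Icc 0 R) ∧ (∀ i, n ≤ i → x.2 i = 0) ∧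
    ∀ c : ℕ → ℝ, (∀ i < n, c i < x.2 i) → x.1 ∈ seminormSeq p (Ordinal.omega0 ^ ξ) c n G}

theorem isClosed_derivSeqGraph (p : Seminorm ℝ E) (ξ : Ordinal.{w}) (R : ℝ) {G : Set E}
    (hG : IsClosed G) (n : ℕ) : IsClosed (derivSeqGraph p ξ R G n) := by
  have h1 : IsClosed {x : E × (ℕ → ℝ) | ∀ i, x.2 i ∈ Set.Icc 0 R} := by
    have : {x : E × (ℕ → ℝ) | ∀ i, x.2 i ∈ Set.Icc 0 R} =
        ⋂ i, (fun x : E × (ℕ → ℝ) => x.2 i) ⁻¹' Set.Icc 0 R := by ext; simp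
    rw [this]
    exact isClosed_iInter fun i => isClosed_Icc.preimage (by fun_prop)
  have h2 : IsClosed {x : E × (ℕ → ℝ) | ∀ i, n ≤ i → x.2 i = 0} := by
    have : {x : E × (ℕ → ℝ) | ∀ i, n ≤ i → x.2 i = 0} =
        ⋂ i, ⋂ (_ : n ≤ i), (fun x : E × (ℕ → ℝ) => x.2 i) ⁻¹' {0} := by ext; simp
    rw [this]
    exact isClosed_iInter fun i => isClosed_iInter fun _ => isClosed_singleton.preimage (by fun_prop)
  have h3 : IsClosed {x : E × (ℕ → ℝ) | ∀ c : ℕ → ℝ, (∀ i < n, c i < x.2 i) →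
      x.1 ∈ seminormSeq p (Ordinal.omega0 ^ ξ) c n G} := by
    have : {x : E × (ℕ → ℝ) | ∀ c : ℕ → ℝ, (∀ i < n, c i < x.2 i) →
        x.1 ∈ seminormSeq p (Ordinal.omega0 ^ ξ) c n G} = ⋂ c : ℕ → ℝ,
        ((⋃ i ∈ Finset.range n, {x : E × (ℕ → ℝ) | x.2 i ≤ c i}) ∪
          {x | x.1 ∈ seminormSeq p (Ordinal.omega0 ^ ξ) c n G}) := by
      ext x
      simp only [Set.mem_iInter, Set.mem_union, Set.mem_ofPred_eq, Set.mem_iUnion,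
        Finset.mem_range, exists_prop]
      refine forall_congr' fun c => ?_
      rw [imp_iff_not_or]
      push Not
      rfl
    rw [this]
    refine isClosed_iInter fun c => (isClosed_biUnion_finset fun i _ => ?_).union
      ((isClosed_seminormSeq _ c n hG).preimage continuous_fst)
    exact isClosed_le (by fun_prop) continuous_const
  exact (hG.preimage continuous_fst).inter (h1.inter (h2.inter h3))

theorem isCompact_closure_convexHull_derivSeqGraph [IsTopologicalAddGroup E] [ContinuousSMul ℝ E]
    (p : Seminorm ℝ E) (ξ : Ordinal.{w}) (R : ℝ) {G : Set E}
    (hC : IsCompact (closure (convexHull ℝ G))) (n : ℕ) :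
    IsCompact (closure (convexHull ℝ (derivSeqGraph p ξ R G n))) := by
  have hpi : IsCompact (Set.univ.pi fun _ : ℕ => Set.Icc (0 : ℝ) R) :=
    isCompact_univ_pi fun _ => isCompact_Icc
  refine (hC.prod hpi).of_isClosed_subset isClosed_closure (closure_convexHull_subset ?_ ?_ ?_)
  · exact fun x hx => ⟨subset_closure_convexHull G hx.1, fun i _ => hx.2.1 i⟩
  · exact (convex_convexHull ℝ G).closure.prod (convex_pi fun i _ => convex_Icc 0 R)
  · exact isClosed_closure.prod (isClosed_set_pi fun i _ => isClosed_Icc)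

/-- Derivation in a product, with the seminorm of the first factor, localizes over open subsets of
the second factor. -/
theorem fst_mem_seminormIter {Y : Type*} [AddCommGroup Y] [Module ℝ Y] [TopologicalSpace Y]
    (p : Seminorm ℝ E) (c : ℝ) (ζ : Ordinal.{w}) {A : Set (E × Y)} {L : Set E} {W : Set Y}
    (hW : IsOpen W) (h : ∀ x ∈ A, x.2 ∈ W → x.1 ∈ L) :
    ∀ x ∈ seminormIter (p.comp (LinearMap.fst ℝ E Y)) c ζ A, x.2 ∈ W →
      x.1 ∈ seminormIter p c ζ L := by
  induction ζ using Ordinal.limitRecOn with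
  | zero => simpa only [seminormIter_zero]
  | add_one ζ ih =>
    simp only [seminormIter_add_one]
    rintro x ⟨hx, hx'⟩ hxW
    refine ⟨ih x hx hxW, fun hc V hV => ?_⟩
    obtain ⟨y, hy, z, hz, hyz⟩ := hx' hc (V ×ˢ W) (prod_mem_nhds hV (hW.mem_nhds hxW))
    exact ⟨y.1, ⟨hy.1.1, ih y hy.2 hy.1.2⟩, z.1, ⟨hz.1.1, ih z hz.2 hz.1.2⟩, hyz⟩
  | limit ζ hζ ih =>
    simp only [seminormIter_limit _ _ hζ, Set.mem_iInter]
    exact fun x hx hxW η => ih η.1 η.2 x (hx η) hxW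

end Sequences

/-! ### Sequences of derivations and the successor case -/

section Transfer

variable {E₀ : Type v} [AddCommGroup E₀] [Module ℝ E₀] [TopologicalSpace E₀]
  {p : Seminorm ℝ E₀}

/-- Each step takes the previous graph as the generating set in `E × (ℕ → ℝ)` and applies the
one-parameter principle. Full sequences, zero from `n` on, keep the ambient space fixed and leave
coordinate `n` free for the new height. -/
theorem TransfersDeriv.seq {ξ : Ordinal.{w}} (h : TransfersDeriv p ξ) {E : Type v}
    [AddCommGroup E] [Module ℝ E] [TopologicalSpace E] [IsTopologicalAddGroup E]
    [ContinuousSMul ℝ E] [LocallyConvexSpace ℝ E] [T2Space E] (π : E →L[ℝ] E₀) {G Q : Set E}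
    {R : ℝ} (hG : IsClosed G) (hC : IsCompact (closure (convexHull ℝ G)))
    (hR : ∀ y ∈ G, ∀ z ∈ G, p.comp π.toLinearMap (y - z) ≤ R) (hQ : IsClosed Q)
    (hQC : Q ⊆ closure (convexHull ℝ G)) {ε : ℕ → ℝ} (hε : ∀ i, 0 ≤ ε i) (n : ℕ) :
    ∀ x ∈ seminormSeq p (Ordinal.omega0 ^ ξ) ε n (π '' Q), ∃ q ∈ Q, π q = x ∧
      (q, fun i => if i < n then ε i / 2 else 0) ∈
        closure (convexHull ℝ (derivSeqGraph (p.comp π.toLinearMap) ξ R G n)) := by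
  induction n with
  | zero =>
    rintro _ ⟨q, hq, rfl⟩
    refine ⟨q, hq, rfl, ?_⟩
    simp only [not_lt_zero, if_false]
    refine map_mem_closure_convexHull (ContinuousLinearMap.inl ℝ E (ℕ → ℝ)) (fun g hg => ?_)
      (hQC hq)
    exact ⟨hg, fun i => ⟨le_rfl, (apply_nonneg _ _).trans (hR g hg g hg)⟩, fun _ _ => rfl,
      fun _ _ => hg⟩
  | succ n ih =>
    intro x hx
    set t : ℕ → ℝ := fun i => if i < n then ε i / 2 else 0 with ht
    set A := derivSeqGraph (p.comp π.toLinearMap) ξ R G n with hA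
    set π' : E × (ℕ → ℝ) →L[ℝ] E₀ := π.comp (ContinuousLinearMap.fst ℝ E (ℕ → ℝ)) with hπ'
    -- Restricting to the fibre over `t` forces the earlier parameters of the new point to remain
    -- the prescribed ones.
    set Q' : Set (E × (ℕ → ℝ)) := (Q ×ˢ {t}) ∩ closure (convexHull ℝ A) with hQ'
    have hx' : x ∈ seminormIter p (ε n) (Ordinal.omega0 ^ ξ) (π' '' Q') := by
      refine seminormIter_mono _ (fun y hy => ?_) le_rfl hx
      obtain ⟨q, hq, hqy, hqA⟩ := ih y hy
      exact ⟨(q, t), ⟨⟨hq, rfl⟩, hqA⟩, hqy⟩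
    obtain ⟨⟨q, a⟩, ⟨⟨hq, ha⟩, -⟩, hqx, hmem⟩ := h (E × (ℕ → ℝ)) π' A Q' R (ε n)
      (isClosed_derivSeqGraph _ ξ R hG n)
      (isCompact_closure_convexHull_derivSeqGraph _ ξ R hC n)
      (fun y hy z hz => hR y.1 hy.1 z.1 hz.1)
      ((hQ.prod isClosed_singleton).inter isClosed_closure) Set.inter_subset_right (hε n) x hx'
    obtain rfl : a = t := ha
    refine ⟨q, hq, hqx, ?_⟩
    let T : (E × (ℕ → ℝ)) × ℝ →L[ℝ] E × (ℕ → ℝ) :=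
      ContinuousLinearMap.fst ℝ (E × (ℕ → ℝ)) ℝ +
        (ContinuousLinearMap.snd ℝ (E × (ℕ → ℝ)) ℝ).smulRight (0, Pi.single n 1)
    have hT : ∀ y, T y = (y.1.1, y.1.2 + Pi.single n y.2) := by
      intro y
      ext i
      · simp [T]
      · by_cases hi : i = n
        · subst hi; simp [T]
        · simp [T, Pi.single_eq_of_ne hi]
    have key := map_mem_closure_convexHull T
      (H := derivSeqGraph (p.comp π.toLinearMap) ξ R G (n + 1)) (fun y hy => ?_) hmem
    · rw [hT] at key
      convert key using 2
      funext i
      simp only [Pi.add_apply, ht]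
      rcases lt_trichotomy i n with hi | rfl | hi
      · simp [hi, hi.ne, hi.trans (Nat.lt_succ_self n)]
      · simp
      · simp [hi.not_gt, hi.ne', not_lt.2 (Nat.succ_le_of_lt hi)]
    · obtain ⟨hyA, hy0, hyR, hy⟩ := hy
      rw [hT]
      refine ⟨hyA.1, fun i => ?_, fun i hi => ?_, fun c hc => ?_⟩
      · by_cases hi : i = n
        · subst hi
          simpa [hyA.2.2.1 i le_rfl] using ⟨hy0, hyR⟩
        · simpa [Pi.single_eq_of_ne hi] using hyA.2.1 i
      · have hin : i ≠ n := by lia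
        simpa [Pi.single_eq_of_ne hin] using hyA.2.2.1 i (by lia)
      · have hcn : c n < y.2 := by simpa [hyA.2.2.1 n le_rfl] using hc n (Nat.lt_succ_self n)
        -- Deriving `A` with the seminorm of the first factor may be localized to this open set of
        -- parameters, over which all points of `A` survive the sequence `c`.
        have hW : IsOpen {a : ℕ → ℝ | ∀ i < n, c i < a i} := by
          have : {a : ℕ → ℝ | ∀ i < n, c i < a i} = ⋂ i ∈ Finset.range n, {a | c i < a i} := by
            ext; simp
          rw [this]
          exact isOpen_biInter_finset fun i _ => isOpen_lt continuous_const (continuous_apply i)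
        refine fst_mem_seminormIter (p.comp π.toLinearMap) (c n) (Ordinal.omega0 ^ ξ) (A := A) hW
          (fun z hz hzW => hz.2.2.2 c hzW) y.1 (hy (c n) hcn) fun i hi => ?_
        simpa [Pi.single_eq_of_ne hi.ne] using hc i (hi.trans (Nat.lt_succ_self n))

/-- Surviving `ω^(ρ+1)` means surviving any number of `ω^ρ` blocks. Averaging the coordinates of a
long parameter sequence preserves `ε / 2`, while a generator whose average exceeds `c` by a fixed
margin has many coordinates above `c`, since each is at most `R`. -/
theorem TransfersDeriv.add_one [T2Space E₀] {ρ : Ordinal.{w}} (h : TransfersDeriv p ρ) :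
    TransfersDeriv p (ρ + 1) := by
  intro E _ _ _ _ _ _ _ π G Q R ε hG hC hR hQ hQC hε x hx
  have hGc : IsCompact G := hC.of_isClosed_subset hG (subset_closure_convexHull G)
  set p' := p.comp π.toLinearMap with hp'
  let δ : ℕ → ℝ := fun m => 1 / (m + 1)
  -- As `m` grows, more blocks are survived with less slack; the intersection of the `D m` lies in
  -- the graph for `ρ + 1`.
  let D : ℕ → Set (E × ℝ) := fun m => {y | y.1 ∈ G ∧ 0 ≤ y.2 ∧ y.2 ≤ R ∧
    ∀ c < y.2 - δ m, y.1 ∈ seminormIter p' c (Ordinal.omega0 ^ ρ * (m : Ordinal.{w})) G}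
  have hδ : ∀ m, 0 < δ m := fun m => by positivity
  have hδanti : Antitone δ := fun m k hmk => by
    dsimp only [δ]
    gcongr
  have hDanti : Antitone D := fun m k hmk y hy => ⟨hy.1, hy.2.1, hy.2.2.1, fun c hc =>
    seminormIter_antitone _ _ _ (by gcongr) (hy.2.2.2 c (by linarith [hδanti hmk]))⟩
  have hpow : ∀ m : ℕ, (Ordinal.omega0 ^ ρ * m : Ordinal.{w}) ≤ Ordinal.omega0 ^ (ρ + 1) := by
    intro m
    rw [Ordinal.opow_add_one]
    gcongr
    exact (Ordinal.natCast_lt_omega0 m).le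
  have hDmem : ∀ m, ∃ q ∈ Q ∩ π ⁻¹' {x}, (q, ε / 2) ∈ closure (convexHull ℝ (D m)) := by
    intro m
    -- With `n' * δ m > m * R`, an average above `c + δ m` cannot come from fewer than `m`
    -- coordinates above `c`.
    obtain ⟨n, hn⟩ := exists_nat_gt (m * R / δ m)
    set n' := n + 1 with hn'
    have hnR : (m : ℝ) * R < n' * δ m := by
      rw [div_lt_iff₀ (hδ m)] at hn
      push_cast [hn']
      nlinarith [hδ m]
    have hx' : x ∈ seminormSeq p (Ordinal.omega0 ^ ρ) (fun _ => ε) n' (π '' Q) := by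
      rw [seminormSeq_const]
      exact seminormIter_antitone _ _ _ (hpow n') hx
    obtain ⟨q, hq, hqx, hmem⟩ := h.seq π hG hC hR hQ hQC (fun _ => hε) n' x hx'
    refine ⟨q, ⟨hq, hqx⟩, ?_⟩
    let S : E × (ℕ → ℝ) →L[ℝ] E × ℝ := (ContinuousLinearMap.fst ℝ E (ℕ → ℝ)).prod
      ((n' : ℝ)⁻¹ • ∑ i ∈ Finset.range n', (ContinuousLinearMap.proj (R := ℝ) (φ := fun _ : ℕ => ℝ)
        i).comp (ContinuousLinearMap.snd ℝ E (ℕ → ℝ)))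
    have hS : ∀ y, S y = (y.1, (n' : ℝ)⁻¹ * ∑ i ∈ Finset.range n', y.2 i) := by
      intro y
      simp [S]
    have hn0 : (0 : ℝ) < n' := by rw [hn']; positivity
    have key := map_mem_closure_convexHull S (H := D m) (fun y hy => ?_) hmem
    · rw [hS] at key
      convert key using 2
      rw [Finset.sum_congr rfl fun i hi => if_pos (Finset.mem_range.1 hi)]
      simp
    · rw [hS]
      obtain ⟨hyG, hyI, -, hy⟩ := hy
      have hle : ∑ i ∈ Finset.range n', y.2 i ≤ n' * R := by
        have := Finset.sum_le_card_nsmul (Finset.range n') y.2 R fun i _ => (hyI i).2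
        simpa using this
      refine ⟨hyG, mul_nonneg (inv_nonneg.2 hn0.le) (Finset.sum_nonneg fun i _ => (hyI i).1), ?_,
        fun c hc => ?_⟩
      · rw [inv_mul_le_iff₀ hn0]
        exact hle
      · rcases le_or_gt c 0 with hc0 | hc0
        · rwa [seminormIter_of_nonpos _ hc0]
        set I := (Finset.range n').filter fun i => c < y.2 i with hI
        have hsum : ∑ i ∈ Finset.range n', y.2 i ≤ I.card * R + n' * c := by
          calc ∑ i ∈ Finset.range n', y.2 i
              ≤ ∑ i ∈ Finset.range n', ((if c < y.2 i then R else 0) + c) := by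
                refine Finset.sum_le_sum fun i _ => ?_
                split_ifs with hi
                · linarith [(hyI i).2]
                · linarith
            _ = I.card * R + n' * c := by
                rw [Finset.sum_add_distrib, ← Finset.sum_filter]
                simp [hI]
        have hmI : m ≤ I.card := by
          have h1 : (n' : ℝ) * (c + δ m) < ∑ i ∈ Finset.range n', y.2 i := by
            rw [← lt_inv_mul_iff₀ hn0]
            linarith
          have h2 : (m : ℝ) * R < I.card * R := by nlinarith
          have hR0 : 0 ≤ R := (apply_nonneg _ _).trans (hR _ hyG _ hyG)
          exact_mod_cast (lt_of_mul_lt_mul_right h2 hR0).le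
        -- The graph demands parameters strictly below `y.2 i` in every coordinate; those not above
        -- `c` only need some admissible value and are dropped afterwards.
        have hmem' := hy (fun i => if c < y.2 i then c else y.2 i - 1) fun i _ => by
          split_ifs with hi
          · exact hi
          · linarith
        have hmem'' := seminormSeq_subset_iter_card _ _ c n' hmem'
        refine seminormIter_antitone _ _ _ ?_ hmem''
        gcongr
        refine hmI.trans (Finset.card_le_card fun i hi => ?_)
        rw [hI, Finset.mem_filter] at hi
        rw [Finset.mem_filter]
        exact ⟨hi.1, by simp [hi.2]⟩
  obtain ⟨q, hq, hmem⟩ := exists_mem_closure_convexHull_iInter (F := Q ∩ π ⁻¹' {x})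
    (D := D) (β := ε / 2)
    ((hC.of_isClosed_subset hQ hQC).inter_right (isClosed_singleton.preimage π.continuous))
    hDanti
    (fun m => (hGc.prod (isCompact_Icc (a := 0) (b := R))).of_isClosed_subset
      (isClosed_setOf_forall_lt_mem_seminormIter _ (δ m) R hG)
      fun y hy => ⟨hy.1, hy.2.1, hy.2.2.1⟩)
    hDmem
  refine ⟨q, hq.1, hq.2, closure_convexHull_mono (fun y hy => ?_) hmem⟩
  rw [Set.mem_iInter] at hy
  refine ⟨(hy 0).1, (hy 0).2.1, (hy 0).2.2.1, fun c hc => ?_⟩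
  rw [Ordinal.opow_add_one, seminormIter_limit _ _ (Ordinal.isSuccLimit_mul_right
    (Ordinal.opow_pos ρ Ordinal.omega0_pos) Ordinal.isSuccLimit_omega0), Set.mem_iInter]
  rintro ⟨ζ, hζ⟩
  obtain ⟨η, hη, hζη⟩ := (Ordinal.lt_mul_iff_of_isSuccLimit Ordinal.isSuccLimit_omega0).1 hζ
  obtain ⟨m, rfl⟩ := Ordinal.lt_omega0.1 hη
  obtain ⟨k, hk⟩ := exists_nat_one_div_lt (sub_pos.2 hc)
  have hmem := (hy (max m k)).2.2.2 c (by
    have := hδanti (le_max_right m k)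
    have hk' : δ k < y.2 - c := hk
    linarith)
  refine seminormIter_antitone _ _ _ (hζη.le.trans ?_) hmem
  gcongr
  exact le_max_left m k

theorem transfersDeriv [T2Space E₀] (hp : ∀ r, IsClosed {x | p x ≤ r}) (ξ : Ordinal.{w}) :
    TransfersDeriv p ξ := by
  induction ξ using Ordinal.limitRecOn with
  | zero => exact transfersDeriv_zero hp
  | add_one ξ ih => exact ih.add_one
  | limit ξ hξ ih => exact transfersDeriv_limit hξ ih

end Transfer

/-! ### Summability passes to closed convex hulls -/

section HullSummability

variable {E : Type v} [AddCommGroup E] [Module ℝ E] [TopologicalSpace E]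
  [IsTopologicalAddGroup E] [ContinuousSMul ℝ E] [LocallyConvexSpace ℝ E] [T2Space E]
  {p : Seminorm ℝ E}

/-- A bound for `∑ a i ^ q` over all the sequences of derivations that leave `G` non-empty passes to
the closed convex hull, up to a factor `2` in the parameters. -/
theorem sum_rpow_le_of_closure_convexHull (hp : ∀ r, IsClosed {x | p x ≤ r}) {ξ : Ordinal.{w}}
    {G : Set E} {R q C : ℝ} (hq : 1 ≤ q) (hG : IsClosed G)
    (hC : IsCompact (closure (convexHull ℝ G))) (hR : ∀ y ∈ G, ∀ z ∈ G, p (y - z) ≤ R)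
    (hsum : ∀ n (a : ℕ → ℝ), (∀ i, 0 ≤ a i) →
      (seminormSeq p (Ordinal.omega0 ^ ξ) a n G).Nonempty →
      ∑ i ∈ Finset.range n, a i ^ q ≤ C) (n : ℕ) {a : ℕ → ℝ} (ha : ∀ i, 0 ≤ a i)
    (hne : (seminormSeq p (Ordinal.omega0 ^ ξ) a n (closure (convexHull ℝ G))).Nonempty) :
    ∑ i ∈ Finset.range n, (a i / 2) ^ q ≤ C := by
  have hq0 : 0 ≤ q := zero_le_one.trans hq
  obtain ⟨x, hx⟩ := hne
  obtain ⟨y, -, -, hy⟩ := (transfersDeriv hp ξ).seq (ContinuousLinearMap.id ℝ E) hG hC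
    (R := R) (by simpa using hR) isClosed_closure subset_rfl ha n x (by simpa using hx)
  have hcont : Continuous fun b : E × (ℕ → ℝ) => ∑ i ∈ Finset.range n, b.2 i ^ q :=
    continuous_finsetSum _ fun i _ => Continuous.rpow_const (by fun_prop) fun _ => Or.inr hq0
  -- The right-hand side is closed, and convex because `t ^ q` is convex for `q ≥ 1`; it is thus
  -- enough to check it on generators.
  have hsub : closure (convexHull ℝ (derivSeqGraph (p.comp (ContinuousLinearMap.id ℝ E).toLinearMap)
      ξ R G n)) ⊆ {b | (∀ i, 0 ≤ b.2 i) ∧ ∑ i ∈ Finset.range n, b.2 i ^ q ≤ C} := by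
    refine closure_convexHull_subset ?_ ?_ ?_
    · rintro ⟨g, b⟩ ⟨-, hbI, -, hb⟩
      refine ⟨fun i => (hbI i).1, ?_⟩
      -- Survival is known only for parameters strictly below `b i`, so `b` is approached from
      -- below; truncation at `0` does not change the derived sets.
      have hlim : Tendsto (fun δ : ℝ => ∑ i ∈ Finset.range n, (max (b i - δ) 0) ^ q) (𝓝[>] 0)
          (𝓝 (∑ i ∈ Finset.range n, b i ^ q)) := by
        have hc : Continuous fun δ : ℝ => ∑ i ∈ Finset.range n, (max (b i - δ) 0) ^ q :=
          continuous_finsetSum _ fun i _ => Continuous.rpow_const (by fun_prop) fun _ => Or.inr hq0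
        have := (hc.tendsto 0).mono_left (nhdsWithin_le_nhds (s := Set.Ioi 0))
        simpa only [sub_zero, max_eq_left (hbI _).1] using this
      refine le_of_tendsto hlim ?_
      filter_upwards [self_mem_nhdsWithin] with δ hδ
      refine hsum n _ (fun i => le_max_right _ _) ⟨g, ?_⟩
      have hmem := hb (fun i => b i - δ) fun i _ => sub_lt_self _ hδ
      change g ∈ seminormSeq (p.comp LinearMap.id) _ _ n G at hmem
      rw [Seminorm.comp_id] at hmem
      have hzero : ∀ m, seminormSeq p (Ordinal.omega0 ^ ξ) (fun i => max (b i - δ) 0) m G =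
          seminormSeq p (Ordinal.omega0 ^ ξ) (fun i => b i - δ) m G := by
        intro m
        induction m with
        | zero => rfl
        | succ m ih =>
          simp only [seminormSeq, ih]
          rcases le_total (b m - δ) 0 with h | h
          · rw [max_eq_right h, seminormIter_of_nonpos _ le_rfl, seminormIter_of_nonpos _ h]
          · rw [max_eq_left h]
      rw [hzero]
      exact hmem
    · rintro b ⟨hb0, hb⟩ c ⟨hc0, hc⟩ s t hs ht hst
      refine ⟨fun i => add_nonneg (mul_nonneg hs (hb0 i)) (mul_nonneg ht (hc0 i)), ?_⟩
      calc ∑ i ∈ Finset.range n, (s • b + t • c).2 i ^ q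
          ≤ ∑ i ∈ Finset.range n, (s * b.2 i ^ q + t * c.2 i ^ q) :=
            Finset.sum_le_sum fun i _ => (convexOn_rpow hq).2 (hb0 i) (hc0 i) hs ht hst
        _ = s * ∑ i ∈ Finset.range n, b.2 i ^ q + t * ∑ i ∈ Finset.range n, c.2 i ^ q := by
            rw [Finset.sum_add_distrib, Finset.mul_sum, Finset.mul_sum]
        _ ≤ s * C + t * C := by gcongr
        _ = C := by rw [← add_mul, hst, one_mul]
    · refine IsClosed.inter ?_ (isClosed_le hcont continuous_const)
      have : {b : E × (ℕ → ℝ) | ∀ i, 0 ≤ b.2 i} = ⋂ i, {b | 0 ≤ b.2 i} := by ext; simp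
      change IsClosed {b : E × (ℕ → ℝ) | ∀ i, 0 ≤ b.2 i}
      rw [this]
      exact isClosed_iInter fun i => isClosed_le continuous_const (by fun_prop)
  have := (hsub hy).2
  simp only at this
  rwa [Finset.sum_congr rfl fun i hi => by rw [if_pos (Finset.mem_range.1 hi)]] at this

end HullSummability

/-! ### The weak* dual: disc multiples and absolutely convex hulls -/

section Dual

variable {𝕜 : Type u} [RCLike 𝕜] {X : Type v} [NormedAddCommGroup X] [NormedSpace 𝕜 X]

instance : LocallyConvexSpace ℝ (WeakDual 𝕜 X) := by
  let f : WeakDual 𝕜 X →ₗ[ℝ] (X → 𝕜) :=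
    { toFun := fun x y => x y
      map_add' := fun _ _ => rfl
      map_smul' := fun _ _ => rfl }
  exact LocallyConvexSpace.induced f

instance : IsScalarTower ℝ 𝕜 (WeakDual 𝕜 X) :=
  ⟨fun r c x => DFunLike.ext _ _ fun y => smul_assoc r c (x y)⟩

/-- The dual norm as a real seminorm on the weak* dual. -/
def dualSeminorm (𝕜 : Type u) [RCLike 𝕜] (X : Type v) [NormedAddCommGroup X] [NormedSpace 𝕜 X] :
    Seminorm ℝ (WeakDual 𝕜 X) where
  toFun x := ‖WeakDual.toStrongDual x‖
  map_zero' := norm_zero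
  add_le' x y := norm_add_le (WeakDual.toStrongDual x) (WeakDual.toStrongDual y)
  neg' x := norm_neg (WeakDual.toStrongDual x)
  smul' r x := norm_smul r (WeakDual.toStrongDual x)

theorem dualSeminorm_apply (x : WeakDual 𝕜 X) :
    dualSeminorm 𝕜 X x = ‖WeakDual.toStrongDual x‖ := rfl

theorem dualSeminorm_smul (c : 𝕜) (x : WeakDual 𝕜 X) :
    dualSeminorm 𝕜 X (c • x) = ‖c‖ * dualSeminorm 𝕜 X x :=
  norm_smul c (WeakDual.toStrongDual x)

theorem isClosed_dualSeminorm_le (r : ℝ) : IsClosed {x | dualSeminorm 𝕜 X x ≤ r} := by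
  have := WeakDual.isClosed_closedBall (𝕜 := 𝕜) (E := X) 0 r
  convert this using 1
  ext x
  simp [dualSeminorm_apply]

theorem derivIter_eq_seminormIter (ε : ℝ) (ζ : Ordinal.{w}) (K : Set (WeakDual 𝕜 X)) :
    derivIter ε ζ K = seminormIter (dualSeminorm 𝕜 X) ε ζ K := rfl

theorem exists_seminormSeq_eq_derivList (ζ : Ordinal.{w}) (q : ℝ) (l : List ℝ)
    (hl : ∀ ε ∈ l, 0 ≤ ε) : ∃ a : ℕ → ℝ, (∀ i, 0 ≤ a i) ∧
      ∑ i ∈ Finset.range l.length, a i ^ q = (l.map fun ε => ε ^ q).sum ∧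
      ∀ K : Set (WeakDual 𝕜 X),
        seminormSeq (dualSeminorm 𝕜 X) ζ a l.length K = derivList ζ l K := by
  induction l with
  | nil => exact ⟨fun _ => 0, fun _ => le_rfl, by simp, fun K => rfl⟩
  | cons ε l ih =>
    obtain ⟨a, ha, hsum, hK⟩ := ih fun δ hδ => hl δ (List.mem_cons_of_mem _ hδ)
    have hne : ∀ i < l.length, Function.update a l.length ε i = a i := fun i hi =>
      Function.update_of_ne hi.ne _ _
    -- The head of the list is derived last, so it takes the last index.
    refine ⟨Function.update a l.length ε, fun i => ?_, ?_, fun K => ?_⟩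
    · rcases eq_or_ne i l.length with rfl | hi
      · simpa using hl ε (by simp)
      · rw [Function.update_of_ne hi]
        exact ha i
    · rw [List.length_cons, Finset.sum_range_succ, List.map_cons, List.sum_cons, ← hsum,
        Function.update_self, add_comm]
      congr 1
      exact Finset.sum_congr rfl fun i hi => by rw [hne i (Finset.mem_range.1 hi)]
    · rw [List.length_cons, seminormSeq, Function.update_self,
        Set.Subset.antisymm (seminormSeq_mono ζ l.length subset_rfl fun i hi => (hne i hi).ge)
          (seminormSeq_mono ζ l.length subset_rfl fun i hi => (hne i hi).le), hK]
      rfl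

theorem exists_derivList_eq_seminormSeq (ζ : Ordinal.{w}) (q : ℝ) (a : ℕ → ℝ)
    (ha : ∀ i, 0 ≤ a i) (n : ℕ) : ∃ l : List ℝ, (∀ ε ∈ l, 0 ≤ ε) ∧
      (l.map fun ε => ε ^ q).sum = ∑ i ∈ Finset.range n, a i ^ q ∧
      ∀ K : Set (WeakDual 𝕜 X),
        derivList ζ l K = seminormSeq (dualSeminorm 𝕜 X) ζ a n K := by
  induction n with
  | zero => exact ⟨[], by simp, by simp, fun K => rfl⟩
  | succ n ih =>
    obtain ⟨l, hl, hsum, hK⟩ := ih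
    refine ⟨a n :: l, ?_, ?_, fun K => ?_⟩
    · simpa using ⟨ha n, hl⟩
    · rw [List.map_cons, List.sum_cons, hsum, Finset.sum_range_succ, add_comm]
    · rw [seminormSeq, ← hK]
      rfl

theorem hasSummableWith_iff {M : ℝ} {ξ : Ordinal.{w}} {q : ℝ} {K : Set (WeakDual 𝕜 X)} :
    HasSummableWith M ξ q K ↔ ∀ n (a : ℕ → ℝ), (∀ i, 0 ≤ a i) →
      (seminormSeq (dualSeminorm 𝕜 X) (Ordinal.omega0 ^ ξ) a n K).Nonempty →
      ∑ i ∈ Finset.range n, a i ^ q ≤ M ^ q := by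
  constructor
  · intro h n a ha hne
    obtain ⟨l, hl, hsum, hK⟩ := exists_derivList_eq_seminormSeq (𝕜 := 𝕜) (X := X)
      (Ordinal.omega0 ^ ξ) q a ha n
    rw [← hsum]
    exact h l hl (by rwa [hK])
  · intro h l hl hne
    obtain ⟨a, ha, hsum, hK⟩ := exists_seminormSeq_eq_derivList (𝕜 := 𝕜) (X := X)
      (Ordinal.omega0 ^ ξ) q l hl
    rw [← hsum]
    exact h _ a ha (by rwa [hK])

theorem HasSummableWith.mono {M : ℝ} {ξ : Ordinal.{w}} {q : ℝ} {K L : Set (WeakDual 𝕜 X)}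
    (h : HasSummableWith M ξ q L) (hKL : K ⊆ L) : HasSummableWith M ξ q K := by
  rw [hasSummableWith_iff] at h ⊢
  exact fun n a ha hne => h n a ha (hne.mono (seminormSeq_mono _ n hKL fun _ _ => le_rfl))

/-- The union of the multiples of the elements of `K` by scalars in the closed unit disc. -/
def discHull (K : Set (WeakDual 𝕜 X)) : Set (WeakDual 𝕜 X) :=
  (fun τ : 𝕜 × WeakDual 𝕜 X => τ.1 • τ.2) '' (Metric.closedBall 0 1 ×ˢ K)

theorem isCompact_discHull {K : Set (WeakDual 𝕜 X)} (hK : IsCompact K) :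
    IsCompact (discHull K) :=
  ((isCompact_closedBall 0 1).prod hK).image (by fun_prop)

/-- Pointwise bounds from weak*-compactness become uniform by Banach-Steinhaus; this is where
completeness of `X` enters. -/
theorem exists_dualSeminorm_le [CompleteSpace X] {K : Set (WeakDual 𝕜 X)} (hK : IsCompact K) :
    ∃ R, 0 ≤ R ∧ ∀ x ∈ K, dualSeminorm 𝕜 X x ≤ R := by
  have hb : ∀ y : X, ∃ C, ∀ x : K, ‖WeakDual.toStrongDual x.1 y‖ ≤ C := by
    intro y
    obtain ⟨C, hC⟩ := (hK.image (f := fun x : WeakDual 𝕜 X => ‖x y‖)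
      (WeakDual.eval_continuous y).norm).bddAbove
    exact ⟨C, fun x => hC ⟨x.1, x.2, rfl⟩⟩
  obtain ⟨C, hC⟩ := banach_steinhaus hb
  exact ⟨max C 0, le_max_right _ _, fun x hx => (hC ⟨x, hx⟩).trans (le_max_left _ _)⟩

/-- The disc is norm-compact, so nearby multiples `c' • t'` and `c • t` can be far apart only if
`t'` and `t` are. One halving of `ε` comes from fixing one of the two points, another from absorbing
`(c' - c) • t`. -/
theorem seminormIter_discHull_subset {ε R : ℝ} (ζ : Ordinal.{w}) {L : Set (WeakDual 𝕜 X)}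
    (hL : IsCompact L) (hR : ∀ x ∈ L, dualSeminorm 𝕜 X x ≤ R) :
    seminormIter (dualSeminorm 𝕜 X) ε ζ (discHull L) ⊆
      discHull (seminormIter (dualSeminorm 𝕜 X) (ε / 4) ζ L) := by
  rcases le_or_gt ε 0 with hε | hε
  · rw [seminormIter_of_nonpos _ hε, seminormIter_of_nonpos _ (by linarith)]
  have hcomp : ∀ η : Ordinal.{w}, IsCompact (seminormIter (dualSeminorm 𝕜 X) (ε / 4) η L) :=
    fun η => hL.of_isClosed_subset (isClosed_seminormIter η hL.isClosed) (seminormIter_subset η)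
  induction ζ using Ordinal.limitRecOn with
  | zero => simp only [seminormIter_zero]; exact subset_rfl
  | add_one ζ ih =>
    simp only [seminormIter_add_one]
    intro x hx
    obtain ⟨⟨c, t⟩, ⟨hc, ht⟩, rfl, hfreq⟩ := exists_frequently_of_mem_seminormDeriv_image
      ((isCompact_closedBall 0 1).prod (hcomp ζ)) (by fun_prop) hε (seminormDeriv_mono ih le_rfl hx)
    refine ⟨(c, t), ⟨hc, ht, fun _ V hV => ?_⟩, rfl⟩
    have e1 : ∀ᶠ τ : 𝕜 × WeakDual 𝕜 X in 𝓝 (c, t), ‖τ.1 - c‖ * R < ε / 4 := by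
      have : Tendsto (fun τ : 𝕜 × WeakDual 𝕜 X => ‖τ.1 - c‖ * R) (𝓝 (c, t))
          (𝓝 (‖c - c‖ * R)) := Continuous.tendsto (by fun_prop) (c, t)
      rw [sub_self, norm_zero, zero_mul] at this
      exact this.eventually (gt_mem_nhds (by linarith))
    have e2 : ∀ᶠ τ : 𝕜 × WeakDual 𝕜 X in 𝓝 (c, t), τ.2 ∈ V := continuousAt_snd.eventually hV
    obtain ⟨⟨c', t'⟩, hlt, ⟨h1, h2⟩, hc', ht'⟩ := (hfreq.and_eventually
      (((e1.and e2).filter_mono nhdsWithin_le_nhds).and self_mem_nhdsWithin)).exists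
    simp only at hlt h1 h2 hc' ht'
    refine ⟨t', ⟨h2, ht'⟩, t, ⟨mem_of_mem_nhds hV, ht⟩, ?_⟩
    have hdec : c' • t' - c • t = c' • (t' - t) + (c' - c) • t := by module
    rw [hdec] at hlt
    have b1 := map_add_le_add (dualSeminorm 𝕜 X) (c' • (t' - t)) ((c' - c) • t)
    rw [dualSeminorm_smul, dualSeminorm_smul] at b1
    have b2 : ‖c'‖ * dualSeminorm 𝕜 X (t' - t) ≤ dualSeminorm 𝕜 X (t' - t) :=
      mul_le_of_le_one_left (apply_nonneg _ _) (mem_closedBall_zero_iff.1 hc')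
    have b3 : ‖c' - c‖ * dualSeminorm 𝕜 X t ≤ ‖c' - c‖ * R :=
      mul_le_mul_of_nonneg_left (hR t (seminormIter_subset ζ ht)) (norm_nonneg _)
    linarith
  | limit ζ hζ ih =>
    have : Nonempty (Set.Iio ζ) := ⟨⟨0, hζ.bot_lt⟩⟩
    intro x hx
    rw [seminormIter_limit _ _ hζ, Set.mem_iInter] at hx
    have hcont : Continuous fun τ : 𝕜 × WeakDual 𝕜 X => τ.1 • τ.2 := by fun_prop
    -- The factorization of `x` may depend on `η`; compactness provides one that serves every `η <
    -- ζ`.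
    let S : Set.Iio ζ → Set (𝕜 × WeakDual 𝕜 X) := fun η => (Metric.closedBall 0 1 ×ˢ
      seminormIter (dualSeminorm 𝕜 X) (ε / 4) η.1 L) ∩ (fun τ => τ.1 • τ.2) ⁻¹' {x}
    have hS : ∀ η, IsCompact (S η) := fun η =>
      ((isCompact_closedBall 0 1).prod (hcomp η.1)).inter_right
        (isClosed_singleton.preimage hcont)
    obtain ⟨τ, hτ⟩ := IsCompact.nonempty_iInter_of_directed_nonempty_isCompact_isClosed S
      (directed_of_isDirected_le fun η θ hηθ => Set.inter_subset_inter_left _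
        (Set.prod_mono_right (seminormIter_antitone _ _ _ hηθ)))
      (fun η => by
        obtain ⟨τ, hτ, hτx⟩ := ih η.1 η.2 (hx η)
        exact ⟨τ, hτ, hτx⟩) hS fun η => (hS η).isClosed
    rw [Set.mem_iInter] at hτ
    have h0 := hτ (Classical.arbitrary _)
    refine ⟨τ, ⟨h0.1.1, ?_⟩, h0.2⟩
    rw [seminormIter_limit _ _ hζ, Set.mem_iInter]
    exact fun η => (hτ η).1.2

theorem seminormSeq_discHull_subset {R : ℝ} (ζ : Ordinal.{w}) {L : Set (WeakDual 𝕜 X)}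
    (hL : IsCompact L) (hR : ∀ x ∈ L, dualSeminorm 𝕜 X x ≤ R) (a : ℕ → ℝ) (n : ℕ) :
    seminormSeq (dualSeminorm 𝕜 X) ζ a n (discHull L) ⊆
      discHull (seminormSeq (dualSeminorm 𝕜 X) ζ (fun i => a i / 4) n L) := by
  induction n with
  | zero => exact subset_rfl
  | succ n ih =>
    refine (seminormIter_mono ζ ih le_rfl).trans (seminormIter_discHull_subset (R := R) ζ ?_ ?_)
    · exact hL.of_isClosed_subset (isClosed_seminormSeq _ _ _ hL.isClosed) (seminormSeq_subset _ _ _)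
    · exact fun x hx => hR x (seminormSeq_subset _ _ _ hx)

theorem subset_weakStarAbsCo (K : Set (WeakDual 𝕜 X)) : K ⊆ weakStarAbsCo K :=
  subset_absConvexHull.trans subset_closure

theorem convex_closure_absConvexHull {E : Type*} [AddCommGroup E] [Module 𝕜 E] [Module ℝ E]
    [IsScalarTower ℝ 𝕜 E] [TopologicalSpace E] [IsTopologicalAddGroup E] [ContinuousConstSMul ℝ E]
    (K : Set E) : Convex ℝ (closure (absConvexHull 𝕜 K)) :=
  (convex_RCLike_iff_convex_real.1 (absConvex_absConvexHull (𝕜 := 𝕜) (s := K)).2).closure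

theorem weakStarAbsCo_subset (K : Set (WeakDual 𝕜 X)) :
    weakStarAbsCo K ⊆ closure (convexHull ℝ (discHull K)) := by
  refine closure_mono (absConvexHull_min ?_ ⟨?_, ?_⟩)
  · exact fun x hx => subset_convexHull ℝ _ ⟨(1, x), ⟨by simp, hx⟩, one_smul 𝕜 x⟩
  · rintro c hc _ ⟨x, hx, rfl⟩
    let T : WeakDual 𝕜 X →ₗ[ℝ] WeakDual 𝕜 X :=
      { toFun := fun y => c • y
        map_add' := smul_add c
        map_smul' := fun r y => smul_comm c r y }
    have hT : T x ∈ convexHull ℝ (T '' discHull K) := by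
      rw [← T.image_convexHull]
      exact ⟨x, hx, rfl⟩
    refine convexHull_mono ?_ hT
    rintro _ ⟨_, ⟨⟨d, t⟩, ⟨hd, ht⟩, rfl⟩, rfl⟩
    refine ⟨(c * d, t), ⟨?_, ht⟩, mul_smul c d t⟩
    rw [mem_closedBall_zero_iff] at hd ⊢
    rw [norm_mul]
    exact mul_le_one₀ hc (norm_nonneg _) hd
  · rw [convex_RCLike_iff_convex_real]
    exact convex_convexHull ℝ _

theorem dualSeminorm_le_of_mem_discHull {K : Set (WeakDual 𝕜 X)} {R : ℝ}
    (hR : ∀ x ∈ K, dualSeminorm 𝕜 X x ≤ R) : ∀ x ∈ discHull K, dualSeminorm 𝕜 X x ≤ R := by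
  rintro _ ⟨⟨c, t⟩, ⟨hc, ht⟩, rfl⟩
  rw [dualSeminorm_smul]
  exact (mul_le_of_le_one_left (apply_nonneg _ _) (mem_closedBall_zero_iff.1 hc)).trans (hR t ht)

theorem isCompact_closure_convexHull_discHull [CompleteSpace X] {K : Set (WeakDual 𝕜 X)}
    (hK : IsCompact K) : IsCompact (closure (convexHull ℝ (discHull K))) := by
  obtain ⟨R, -, hR⟩ := exists_dualSeminorm_le hK
  refine (WeakDual.isCompact_closedBall (0 : StrongDual 𝕜 X) R).of_isClosed_subset isClosed_closure ?_
  have hcl := isClosed_dualSeminorm_le (𝕜 := 𝕜) (X := X) R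
  have hconv := convex_seminorm_sub_le (E := WeakDual 𝕜 X) (dualSeminorm 𝕜 X) 0 R
  simp only [sub_zero] at hconv
  refine (closure_convexHull_subset (dualSeminorm_le_of_mem_discHull hR) hconv hcl).trans fun x hx => ?_
  have hx' : dualSeminorm 𝕜 X x ≤ R := hx
  simpa [dualSeminorm_apply] using hx'

theorem isCompact_weakStarAbsCo [CompleteSpace X] {K : Set (WeakDual 𝕜 X)} (hK : IsCompact K) :
    IsCompact (weakStarAbsCo K) :=
  (isCompact_closure_convexHull_discHull hK).of_isClosed_subset isClosed_closure
    (weakStarAbsCo_subset K)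

/-- The constant is `8 = 4 * 2`: a factor `4` for disc multiples and `2` for the convex hull. -/
theorem HasSummableWith.weakStarAbsCo [CompleteSpace X] {M : ℝ} {ξ : Ordinal.{w}} {q : ℝ}
    (hq : 1 ≤ q) (hM : 0 ≤ M) {K : Set (WeakDual 𝕜 X)} (hK : IsCompact K)
    (h : HasSummableWith M ξ q K) : HasSummableWith (8 * M) ξ q (weakStarAbsCo K) := by
  obtain ⟨R, hR0, hR⟩ := exists_dualSeminorm_le hK
  have hdisc := dualSeminorm_le_of_mem_discHull hR
  have hcompact := isCompact_closure_convexHull_discHull hK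
  refine HasSummableWith.mono ?_ (weakStarAbsCo_subset K)
  rw [hasSummableWith_iff] at h ⊢
  intro n a ha hne
  have key := sum_rpow_le_of_closure_convexHull (p := dualSeminorm 𝕜 X) (R := 2 * R)
    (C := (4 * M) ^ q) isClosed_dualSeminorm_le hq (isCompact_discHull hK).isClosed hcompact
    (fun y hy z hz => ?_) (fun m b hb hb' => ?_) n ha hne
  · have : ∀ i, (a i / 2) ^ q = a i ^ q / 2 ^ q := fun i => Real.div_rpow (ha i) (by norm_num) q
    simp only [this] at key
    rw [← Finset.sum_div, div_le_iff₀ (by positivity),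
      ← Real.mul_rpow (by positivity) (by norm_num)] at key
    rwa [show 4 * M * 2 = 8 * M by ring] at key
  · have := map_sub_le_add (dualSeminorm 𝕜 X) y z
    linarith [hdisc y hy, hdisc z hz]
  · obtain ⟨x, hx⟩ := hb'
    obtain ⟨τ, hτ, -⟩ := seminormSeq_discHull_subset _ hK hR b m hx
    have key := h m (fun i => b i / 4) (fun i => div_nonneg (hb i) (by norm_num)) ⟨τ.2, hτ.2⟩
    have : ∀ i, (b i / 4) ^ q = b i ^ q / 4 ^ q := fun i => Real.div_rpow (hb i) (by norm_num) q
    simp only [this] at key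
    rw [← Finset.sum_div, div_le_iff₀ (by positivity), ← Real.mul_rpow hM (by norm_num)] at key
    rwa [mul_comm] at key

theorem hasSummable_weakStarAbsCo_iff [CompleteSpace X] {ξ : Ordinal.{w}} {q : ℝ} (hq : 1 ≤ q)
    {K : Set (WeakDual 𝕜 X)} (hK : IsCompact K) :
    HasSummable ξ q K ↔ HasSummable ξ q (SzlenkIndex.weakStarAbsCo K) :=
  ⟨fun ⟨M, hM, h⟩ => ⟨8 * M, by positivity, h.weakStarAbsCo hq hM hK⟩,
    fun ⟨M, hM, h⟩ => ⟨M, hM, h.mono (subset_weakStarAbsCo K)⟩⟩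

end Dual

/-! ### Derivations of convex sets under translation and scaling -/

section Similarity

variable {E F : Type*} [AddCommGroup E] [Module ℝ E] [TopologicalSpace E]
  [AddCommGroup F] [Module ℝ F] [TopologicalSpace F]

theorem map_mem_seminormIter {p : Seminorm ℝ E} {p' : Seminorm ℝ F} {T : E → F}
    (hT : Continuous T) {r : ℝ} (hr : 0 < r) (hp : ∀ y z, r * p (y - z) ≤ p' (T y - T z))
    {A : Set E} {B : Set F} (hAB : ∀ x ∈ A, T x ∈ B) (ε : ℝ) (ζ : Ordinal.{w}) :
    ∀ x ∈ seminormIter p ε ζ A, T x ∈ seminormIter p' (r * ε) ζ B := by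
  induction ζ using Ordinal.limitRecOn with
  | zero => simpa only [seminormIter_zero]
  | add_one ζ ih =>
    simp only [seminormIter_add_one]
    rintro x ⟨hx, hx'⟩
    refine ⟨ih x hx, fun hε V hV => ?_⟩
    obtain ⟨y, hy, z, hz, hyz⟩ := hx' (pos_of_mul_pos_right hε hr.le) (T ⁻¹' V)
      (hT.continuousAt hV)
    exact ⟨T y, ⟨hy.1, ih y hy.2⟩, T z, ⟨hz.1, ih z hz.2⟩,
      (mul_lt_mul_of_pos_left hyz hr).trans_le (hp y z)⟩
  | limit ζ hζ ih =>
    simp only [seminormIter_limit _ _ hζ, Set.mem_iInter]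
    exact fun x hx η => ih η.1 η.2 x (hx η)

/-- A point that survives the derivation `s_ε^ζ` of `A` survives `s_{ε/n}^{ζ n}` in every convex set
containing `A`. -/
theorem mem_seminormIter_mul_nat [ContinuousAdd E] [ContinuousSMul ℝ E] {p : Seminorm ℝ E}
    {A C : Set E} (hAC : A ⊆ C) (hC : Convex ℝ C) {ε : ℝ} {ζ : Ordinal.{w}} {x : E}
    (hx : x ∈ seminormIter p ε ζ A) {n : ℕ} (hn : n ≠ 0) :
    x ∈ seminormIter p (ε / n) (ζ * n) C := by
  have key : ∀ m : ℕ, (m : ℝ) • x ∈ seminormIter p ε (ζ * m) ((fun y => (m : ℝ) • y) '' C) := by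
    intro m
    induction m with
    | zero =>
      rw [Nat.cast_zero, Nat.cast_zero, mul_zero, seminormIter_zero]
      exact ⟨x, hAC (seminormIter_subset ζ hx), rfl⟩
    | succ m ih =>
      rw [Nat.cast_succ (R := Ordinal.{w}), mul_add_one, seminormIter_add]
      -- By convexity `a + m C ⊆ (m + 1) C`, so the whole translate `A + m x` survives `ζ * m`;
      -- since `x` survives `ζ` in `A`, its translate survives another block `ζ`.
      have h1 : ∀ a ∈ A, a + (m : ℝ) • x ∈ seminormIter p ε (ζ * m)
          ((fun y => ((m + 1 : ℕ) : ℝ) • y) '' C) := by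
        intro a ha
        have := map_mem_seminormIter (p := p) (p' := p) (T := fun y => a + y) (by fun_prop)
          one_pos (fun y z => by simp) (B := (fun y => ((m + 1 : ℕ) : ℝ) • y) '' C) ?_ ε (ζ * m)
          _ ih
        · simpa using this
        · rintro _ ⟨c, hc, rfl⟩
          have hm : (0 : ℝ) < m + 1 := by positivity
          refine ⟨(1 / ((m : ℝ) + 1)) • a + ((m : ℝ) / (m + 1)) • c,
            hC (hAC ha) hc (by positivity) (by positivity)
              (by rw [← add_div, add_comm, div_self hm.ne']), ?_⟩
          simp only [Nat.cast_succ, smul_add, smul_smul]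
          rw [mul_one_div_cancel hm.ne', mul_div_cancel₀ _ hm.ne', one_smul]
      have := map_mem_seminormIter (p := p) (p' := p) (T := fun y => y + (m : ℝ) • x)
        (by fun_prop) one_pos (fun y z => by simp) h1 ε ζ x hx
      rw [one_mul] at this
      convert this using 1
      push_cast
      module
  have hn0 : (0 : ℝ) < n := by positivity
  have := map_mem_seminormIter (p := p) (p' := p) (T := fun y => (n : ℝ)⁻¹ • y) (by fun_prop)
    (inv_pos.2 hn0) (fun y z => ?_) (B := C) ?_ ε (ζ * n) _ (key n)
  · rwa [inv_smul_smul₀ hn0.ne', ← div_eq_inv_mul] at this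
  · rw [← smul_sub, map_smul_eq_mul, Real.norm_of_nonneg (inv_nonneg.2 hn0.le)]
  · rintro _ ⟨c, hc, rfl⟩
    simpa only [inv_smul_smul₀ hn0.ne'] using hc

end Similarity

/-! ### From counting large terms to summability -/

section Counting

/-- The `j`-th largest term is at most `B / j ^ (1 / r)`, as seen by taking it for the threshold
`c`. The induction removes the smallest term, so no sorting is needed. -/
theorem sum_rpow_le_of_card_le {ι : Type*} [DecidableEq ι] {a : ι → ℝ} {B q r : ℝ} (hB : 0 ≤ B)
    (hr : 0 < r) (hq : 0 < q) (S : Finset ι) (ha : ∀ i ∈ S, 0 ≤ a i)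
    (hcard : ∀ c > 0, ((S.filter fun i => c ≤ a i).card : ℝ) ≤ (B / c) ^ r) :
    ∑ i ∈ S, a i ^ q ≤ B ^ q * ∑ j ∈ Finset.range S.card, 1 / ((j + 1 : ℕ) : ℝ) ^ (q / r) := by
  induction hn : S.card generalizing S with
  | zero => simp [Finset.card_eq_zero.1 hn]
  | succ n ih =>
    have hS : S.Nonempty := Finset.card_pos.1 (by lia)
    obtain ⟨i, hi, hmin⟩ := S.exists_min_image a hS
    have h1 := ih (S.erase i) (fun j hj => ha j (Finset.mem_of_mem_erase hj))
      (fun c hc => le_trans (by gcongr; exact Finset.erase_subset i S) (hcard c hc))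
      (by rw [Finset.card_erase_of_mem hi, hn, Nat.add_sub_cancel])
    rw [← Finset.add_sum_erase _ _ hi, Finset.sum_range_succ, mul_add, add_comm]
    refine add_le_add h1 ?_
    rcases (ha i hi).eq_or_lt with h0 | h0
    · rw [← h0, Real.zero_rpow hq.ne']
      positivity
    · have h2 := hcard (a i) h0
      rw [Finset.filter_true_of_mem hmin, hn] at h2
      have h3 : ((n + 1 : ℕ) : ℝ) ^ (q / r) ≤ B ^ q / a i ^ q := by
        calc ((n + 1 : ℕ) : ℝ) ^ (q / r) ≤ ((B / a i) ^ r) ^ (q / r) := by gcongr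
          _ = (B / a i) ^ q := by
              rw [← Real.rpow_mul (by positivity), mul_div_cancel₀ _ hr.ne']
          _ = B ^ q / a i ^ q := Real.div_rpow hB h0.le q
      have h4 : 0 < a i ^ q := Real.rpow_pos_of_pos h0 q
      have h5 : (0 : ℝ) < ((n + 1 : ℕ) : ℝ) ^ (q / r) := by positivity
      rw [mul_one_div, le_div_iff₀ h5]
      rw [le_div_iff₀ h4] at h3
      linarith

end Counting

/-! ### Power types -/

section PowerType

variable {𝕜 : Type u} [RCLike 𝕜] {X : Type v} [NormedAddCommGroup X] [NormedSpace 𝕜 X]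

theorem derivIter_mono {K L : Set (WeakDual 𝕜 X)} {ε ε' : ℝ} (ζ : Ordinal.{w}) (hKL : K ⊆ L)
    (hε : ε' ≤ ε) : derivIter ε ζ K ⊆ derivIter ε' ζ L := by
  simp only [derivIter_eq_seminormIter]
  exact seminormIter_mono ζ hKL hε

theorem derivIter_antitone (ε : ℝ) (K : Set (WeakDual 𝕜 X)) {ζ η : Ordinal.{w}} (h : ζ ≤ η) :
    derivIter ε η K ⊆ derivIter ε ζ K := by
  simp only [derivIter_eq_seminormIter]
  exact seminormIter_antitone _ ε K h

theorem isCompact_derivIter {K : Set (WeakDual 𝕜 X)} (hK : IsCompact K) (ε : ℝ) (ζ : Ordinal.{w}) :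
    IsCompact (derivIter ε ζ K) := by
  rw [derivIter_eq_seminormIter]
  exact hK.of_isClosed_subset (isClosed_seminormIter ζ hK.isClosed) (seminormIter_subset ζ)

theorem szlenkAt_le_iff {K : Set (WeakDual 𝕜 X)} {ε : ℝ} {ζ : Ordinal.{w}} :
    szlenkAt K ε ≤ (ζ : WithTop Ordinal.{w}) ↔ derivIter ε ζ K = ∅ := by
  constructor
  · intro h
    have hne : ((fun ζ : Ordinal.{w} => (ζ : WithTop Ordinal.{w})) ''
        {ζ | derivIter ε ζ K = ∅}).Nonempty := by
      by_contra hemp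
      rw [szlenkAt, Set.not_nonempty_iff_eq_empty.1 hemp, sInf_empty, top_le_iff] at h
      exact WithTop.coe_ne_top h
    obtain ⟨η, hη, hηeq⟩ := csInf_mem hne
    rw [szlenkAt, ← hηeq, WithTop.coe_le_coe] at h
    refine Set.subset_eq_empty ?_ hη
    exact derivIter_antitone ε K h
  · exact fun h => sInf_le ⟨ζ, h, rfl⟩

theorem szlenk_le_iff {K : Set (WeakDual 𝕜 X)} {ζ : Ordinal.{w}} :
    szlenk K ≤ (ζ : WithTop Ordinal.{w}) ↔ ∀ ε > 0, derivIter ε ζ K = ∅ := by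
  simp only [szlenk, iSup_le_iff, szlenkAt_le_iff, Subtype.forall, gt_iff_lt]

/-- The ordinals `ω^ξ * n` are cofinal in `ω^(ξ+1)`, and a decreasing sequence of non-empty compact
sets has a common point. -/
theorem exists_nat_derivIter_eq_empty {K : Set (WeakDual 𝕜 X)} (hK : IsCompact K) {ε : ℝ}
    {ξ : Ordinal.{w}} (h : derivIter ε (Ordinal.omega0 ^ (ξ + 1)) K = ∅) :
    ∃ n : ℕ, derivIter ε (Ordinal.omega0 ^ ξ * n) K = ∅ := by
  by_contra! hne
  have hcomp (n : ℕ) := isCompact_derivIter hK ε (Ordinal.omega0 ^ ξ * n)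
  obtain ⟨x, hx⟩ := IsCompact.nonempty_iInter_of_directed_nonempty_isCompact_isClosed
    (fun n : ℕ => derivIter ε (Ordinal.omega0 ^ ξ * n) K)
    (directed_of_isDirected_le fun m n hmn => derivIter_antitone ε K (by gcongr)) hne hcomp
    fun n => (hcomp n).isClosed
  rw [Set.mem_iInter] at hx
  refine Set.eq_empty_iff_forall_notMem.1 h x ?_
  rw [Ordinal.opow_add_one, derivIter_limit _ _ (Ordinal.isSuccLimit_mul_right
    (Ordinal.opow_pos ξ Ordinal.omega0_pos) Ordinal.isSuccLimit_omega0), Set.mem_iInter]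
  rintro ⟨ζ, hζ⟩
  obtain ⟨η, hη, hζη⟩ := (Ordinal.lt_mul_iff_of_isSuccLimit Ordinal.isSuccLimit_omega0).1 hζ
  obtain ⟨m, rfl⟩ := Ordinal.lt_omega0.1 hη
  exact derivIter_antitone ε K hζη.le (hx m)

theorem szlenkNat_le {K : Set (WeakDual 𝕜 X)} {ε : ℝ} {ξ : Ordinal.{w}} {n : ℕ}
    (h : derivIter ε (Ordinal.omega0 ^ ξ * n) K = ∅) : szlenkNat ξ K ε ≤ n :=
  Nat.sInf_le (szlenkAt_le_iff.2 h)

theorem derivIter_szlenkNat {K : Set (WeakDual 𝕜 X)} (hK : IsCompact K) {ε : ℝ}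
    {ξ : Ordinal.{w}} (h : derivIter ε (Ordinal.omega0 ^ (ξ + 1)) K = ∅) :
    derivIter ε (Ordinal.omega0 ^ ξ * szlenkNat ξ K ε) K = ∅ := by
  obtain ⟨n, hn⟩ := exists_nat_derivIter_eq_empty hK h
  exact szlenkAt_le_iff.1 (Nat.sInf_mem (s := {n : ℕ | szlenkAt K ε ≤
    ((Ordinal.omega0 ^ ξ * (n : Ordinal.{w}) : Ordinal.{w}) : WithTop Ordinal.{w})})
    ⟨n, szlenkAt_le_iff.2 hn⟩)

theorem lt_szlenkNat {K : Set (WeakDual 𝕜 X)} (hK : IsCompact K) {ε : ℝ}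
    {ξ : Ordinal.{w}} (h : derivIter ε (Ordinal.omega0 ^ (ξ + 1)) K = ∅) {n : ℕ}
    (hn : (derivIter ε (Ordinal.omega0 ^ ξ * n) K).Nonempty) : n < szlenkNat ξ K ε := by
  by_contra! hle
  have hsub : derivIter ε (Ordinal.omega0 ^ ξ * n) K ⊆
      derivIter ε (Ordinal.omega0 ^ ξ * szlenkNat ξ K ε) K :=
    derivIter_antitone ε K (by gcongr)
  rw [derivIter_szlenkNat hK h] at hsub
  exact hn.ne_empty (Set.subset_empty_iff.1 hsub)

theorem powerType_mono {K L : Set (WeakDual 𝕜 X)} (hKL : K ⊆ L) (hL : IsCompact L)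
    (ξ : Ordinal.{w}) : powerType ξ K ≤ powerType ξ L := by
  by_cases h : szlenk L ≤ ((Ordinal.omega0 ^ (ξ + 1) : Ordinal.{w}) : WithTop Ordinal.{w})
  swap
  · rw [powerType, powerType, if_neg h]
    exact le_top
  have hsub (ε : ℝ) (ζ : Ordinal.{w}) : derivIter ε ζ K ⊆ derivIter ε ζ L :=
    derivIter_mono ζ hKL le_rfl
  have hK : szlenk K ≤ ((Ordinal.omega0 ^ (ξ + 1) : Ordinal.{w}) : WithTop Ordinal.{w}) :=
    szlenk_le_iff.2 fun ε hε => Set.subset_eq_empty (hsub ε _) (szlenk_le_iff.1 h ε hε)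
  rw [powerType, powerType, if_pos h, if_pos hK]
  refine limsup_le_limsup ?_
  filter_upwards [self_mem_nhdsWithin] with ε hε
  have hle : szlenkNat ξ K ε ≤ szlenkNat ξ L ε :=
    szlenkNat_le (Set.subset_eq_empty (hsub ε _)
      (derivIter_szlenkNat hL (szlenk_le_iff.1 h ε hε)))
  rw [EReal.coe_le_coe_iff]
  refine div_le_div_of_nonneg_right ?_ (abs_nonneg _)
  rcases Nat.eq_zero_or_pos (szlenkNat ξ K ε) with h0 | h0
  · rw [h0, Nat.cast_zero, Real.log_zero]
    exact Real.log_natCast_nonneg _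
  · exact Real.log_le_log (by exact_mod_cast h0) (by exact_mod_cast hle)

theorem tendsto_add_div_abs_log (a b : ℝ) :
    Tendsto (fun ε : ℝ => ((a + b / |Real.log ε| : ℝ) : EReal)) (𝓝[>] 0) (𝓝 (a : EReal)) := by
  refine (continuous_coe_real_ereal.tendsto a).comp ?_
  have h : Tendsto (fun ε : ℝ => |Real.log ε|) (𝓝[>] 0) atTop :=
    tendsto_abs_atBot_atTop.comp Real.tendsto_log_nhdsGT_zero
  simpa using (h.const_div_atTop b).const_add a

/-- A constant sequence of `n` parameters `ε` gives `n * ε ^ q ≤ M ^ q`, so `Sz_ξ(K, ε)` is at most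
a constant times `ε ^ (-q)` for small `ε`. -/
theorem HasSummableWith.powerType_le {M : ℝ} {ξ : Ordinal.{w}} {q : ℝ} (hM : 0 ≤ M) (hq : 0 ≤ q)
    {K : Set (WeakDual 𝕜 X)} (h : HasSummableWith M ξ q K) : powerType ξ K ≤ q := by
  have hempty : ∀ ε > 0, derivIter ε (Ordinal.omega0 ^ ξ * ((⌊M ^ q / ε ^ q⌋₊ + 1 : ℕ) : Ordinal))
      K = ∅ := by
    intro ε hε
    by_contra hne
    have h1 := hasSummableWith_iff.1 h (⌊M ^ q / ε ^ q⌋₊ + 1) (fun _ => ε) (fun _ => hε.le) (by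
      rw [seminormSeq_const, ← derivIter_eq_seminormIter]
      exact Set.nonempty_iff_ne_empty.2 hne)
    rw [Finset.sum_const, Finset.card_range, nsmul_eq_mul,
      ← le_div_iff₀ (Real.rpow_pos_of_pos hε q)] at h1
    push_cast at h1
    linarith [Nat.lt_floor_add_one (M ^ q / ε ^ q)]
  have hsz : szlenk K ≤ ((Ordinal.omega0 ^ (ξ + 1) : Ordinal.{w}) : WithTop Ordinal.{w}) := by
    refine szlenk_le_iff.2 fun ε hε => Set.subset_eq_empty ?_ (hempty ε hε)
    refine derivIter_antitone ε K ?_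
    rw [Ordinal.opow_add_one]
    gcongr
    exact (Ordinal.natCast_lt_omega0 _).le
  rw [powerType, if_pos hsz]
  refine le_trans (limsup_le_limsup ?_)
    (tendsto_add_div_abs_log q (Real.log (M ^ q + 1))).limsup_eq.le
  filter_upwards [Ioo_mem_nhdsGT (zero_lt_one (α := ℝ))] with ε hε
  have hlog : 0 < |Real.log ε| := abs_pos.2 (Real.log_neg hε.1 hε.2).ne
  have hA : 0 ≤ M ^ q := Real.rpow_nonneg hM q
  rw [EReal.coe_le_coe_iff, div_le_iff₀ hlog, add_mul, div_mul_cancel₀ _ hlog.ne']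
  rcases Nat.eq_zero_or_pos (szlenkNat ξ K ε) with h0 | h0
  · rw [h0, Nat.cast_zero, Real.log_zero]
    exact add_nonneg (by positivity) (Real.log_nonneg (by linarith))
  · have hle : (szlenkNat ξ K ε : ℝ) ≤ (M ^ q + 1) * ε ^ (-q) := by
      have h1 : (szlenkNat ξ K ε : ℝ) ≤ ⌊M ^ q / ε ^ q⌋₊ + 1 := by
        exact_mod_cast szlenkNat_le (hempty ε hε.1)
      have h2 : (⌊M ^ q / ε ^ q⌋₊ : ℝ) ≤ M ^ q / ε ^ q :=
        Nat.floor_le (div_nonneg hA (Real.rpow_nonneg hε.1.le q))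
      have h3 : 1 ≤ ε ^ (-q) :=
        Real.one_le_rpow_of_pos_of_le_one_of_nonpos hε.1 hε.2.le (by linarith)
      rw [div_eq_mul_inv, ← Real.rpow_neg hε.1.le] at h1 h2
      linarith
    calc Real.log (szlenkNat ξ K ε) ≤ Real.log ((M ^ q + 1) * ε ^ (-q)) :=
          Real.log_le_log (by exact_mod_cast h0) hle
      _ = q * |Real.log ε| + Real.log (M ^ q + 1) := by
          rw [Real.log_mul (by positivity) (Real.rpow_pos_of_pos hε.1 _).ne',
            Real.log_rpow hε.1, abs_of_neg (Real.log_neg hε.1 hε.2)]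
          ring

/-- A point surviving `s_δ^{ω^ξ}` of `K` survives `n = ⌊δ / ε⌋` blocks of `ε`-derivations in the
convex hull, so `Sz_ξ` there grows at least like `δ / ε`. -/
theorem one_le_powerType_weakStarAbsCo [CompleteSpace X] {K : Set (WeakDual 𝕜 X)}
    (hK : IsCompact K) {ξ : Ordinal.{w}}
    (h : ((Ordinal.omega0 ^ ξ : Ordinal.{w}) : WithTop Ordinal.{w}) < szlenk K) :
    1 ≤ powerType ξ (weakStarAbsCo K) := by
  by_cases hsz : szlenk (weakStarAbsCo K) ≤
    ((Ordinal.omega0 ^ (ξ + 1) : Ordinal.{w}) : WithTop Ordinal.{w})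
  swap
  · rw [powerType, if_neg hsz]
    exact le_top
  rw [← not_le, szlenk_le_iff] at h
  push Not at h
  obtain ⟨δ, hδ, x, hx⟩ := h
  rw [powerType, if_pos hsz]
  rw [← EReal.coe_one]
  refine le_trans (tendsto_add_div_abs_log 1 (Real.log δ)).limsup_eq.ge (limsup_le_limsup ?_)
  filter_upwards [Ioo_mem_nhdsGT (lt_min hδ (zero_lt_one (α := ℝ)))] with ε hε
  have hε1 : ε < 1 := hε.2.trans_le (min_le_right _ _)
  have hεδ : ε < δ := hε.2.trans_le (min_le_left _ _)
  have hlog : 0 < |Real.log ε| := abs_pos.2 (Real.log_neg hε.1 hε1).ne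
  rw [EReal.coe_le_coe_iff, le_div_iff₀ hlog, add_mul, div_mul_cancel₀ _ hlog.ne']
  have hone : 1 ≤ δ / ε := (one_le_div hε.1).2 hεδ.le
  have hn : ⌊δ / ε⌋₊ ≠ 0 := (Nat.floor_pos.2 hone).ne'
  have hn' : (0 : ℝ) < ⌊δ / ε⌋₊ := by positivity
  rw [derivIter_eq_seminormIter] at hx
  have hmem := mem_seminormIter_mul_nat (subset_weakStarAbsCo K)
    (convex_closure_absConvexHull (𝕜 := 𝕜) K) hx hn
  rw [← derivIter_eq_seminormIter] at hmem
  have hle : ε ≤ δ / ⌊δ / ε⌋₊ := by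
    rw [le_div_iff₀ hn', mul_comm, ← le_div_iff₀ hε.1]
    exact Nat.floor_le (by positivity)
  have hlt := lt_szlenkNat (isCompact_weakStarAbsCo hK) (szlenk_le_iff.1 hsz ε hε.1)
    ⟨x, derivIter_mono _ subset_rfl hle hmem⟩
  have hbig : δ / ε ≤ szlenkNat ξ (weakStarAbsCo K) ε := by
    have : ((⌊δ / ε⌋₊ + 1 : ℕ) : ℝ) ≤ szlenkNat ξ (weakStarAbsCo K) ε := by exact_mod_cast hlt
    push_cast at this
    linarith [Nat.lt_floor_add_one (δ / ε)]
  calc 1 * |Real.log ε| + Real.log δ = Real.log (δ / ε) := by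
        rw [Real.log_div hδ.ne' hε.1.ne', abs_of_neg (Real.log_neg hε.1 hε1)]
        ring
    _ ≤ Real.log (szlenkNat ξ (weakStarAbsCo K) ε) := Real.log_le_log (by positivity) hbig

/-- At most `(B / c) ^ r` parameters can be at least `c`, since the others may be dropped; as `q / r
> 1`, their `q`-th powers are dominated by a convergent series. -/
theorem hasSummable_of_powerType_lt [CompleteSpace X] {K : Set (WeakDual 𝕜 X)} (hK : IsCompact K)
    {ξ : Ordinal.{w}} {r q : ℝ} (hr : 0 < r) (hrq : r < q) (h : powerType ξ K < r) :
    HasSummable ξ q K := by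
  have hsz : szlenk K ≤ ((Ordinal.omega0 ^ (ξ + 1) : Ordinal.{w}) : WithTop Ordinal.{w}) := by
    by_contra hsz
    rw [powerType, if_neg hsz] at h
    exact not_top_lt h
  rw [powerType, if_pos hsz] at h
  obtain ⟨δ, hδ, hδlt⟩ := (mem_nhdsGT_iff_exists_Ioo_subset).1
    ((eventually_lt_of_limsup_lt h).and (Ioo_mem_nhdsGT (zero_lt_one (α := ℝ))))
  obtain ⟨R, hR0, hR⟩ := exists_dualSeminorm_le hK
  have hcount : ∀ ε ∈ Set.Ioo 0 δ, ∀ n : ℕ,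
      (derivIter ε (Ordinal.omega0 ^ ξ * n) K).Nonempty → (n : ℝ) ≤ (1 / ε) ^ r := by
    intro ε hε n hn
    obtain ⟨h1, -, hε1⟩ := hδlt hε
    have hlt := lt_szlenkNat hK (szlenk_le_iff.1 hsz ε hε.1) hn
    have hlog : 0 < |Real.log ε| := abs_pos.2 (Real.log_neg hε.1 hε1).ne
    rw [EReal.coe_lt_coe_iff, div_lt_iff₀ hlog, abs_of_neg (Real.log_neg hε.1 hε1),
      ← Real.log_inv, ← Real.log_rpow (inv_pos.2 hε.1)] at h1
    have h2 := (Real.log_lt_log_iff (by exact_mod_cast (Nat.zero_le n).trans_lt hlt)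
      (Real.rpow_pos_of_pos (inv_pos.2 hε.1) r)).1 h1
    rw [one_div]
    exact le_trans (by exact_mod_cast hlt.le) h2.le
  have hδ0 : (0 : ℝ) < δ := hδ
  -- The power type controls only `c < δ`. Larger `c` are compared with `δ / 2`; they are at most `2
  -- * R + 1` unless the count is zero.
  set B := max 1 ((2 * R + 1) / (δ / 2)) with hB
  have hB0 : 0 < B := zero_lt_one.trans_le (le_max_left _ _)
  have hq0 : 0 < q := hr.trans hrq
  have hsummable : Summable fun j : ℕ => 1 / ((j + 1 : ℕ) : ℝ) ^ (q / r) :=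
    (summable_nat_add_iff 1).2 (Real.summable_one_div_nat_rpow.2 ((one_lt_div hr).2 hrq))
  set S := B ^ q * ∑' j : ℕ, 1 / ((j + 1 : ℕ) : ℝ) ^ (q / r) with hS
  have hS0 : 0 ≤ S := mul_nonneg (by positivity) (tsum_nonneg fun j => by positivity)
  refine ⟨S ^ (1 / q), by positivity, ?_⟩
  rw [hasSummableWith_iff]
  intro n a ha hne
  rw [← Real.rpow_mul hS0, one_div_mul_cancel hq0.ne', Real.rpow_one]
  refine (sum_rpow_le_of_card_le hB0.le hr hq0 (Finset.range n) (fun i _ => ha i) ?_).trans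
    (mul_le_mul_of_nonneg_left (hsummable.sum_le_tsum _ fun j _ => by positivity) (by positivity))
  have hcard (c : ℝ) : (derivIter c (Ordinal.omega0 ^ ξ *
      (((Finset.range n).filter fun i => c ≤ a i).card : Ordinal.{w})) K).Nonempty := by
    rw [derivIter_eq_seminormIter]
    exact hne.mono (seminormSeq_subset_iter_card _ a c n)
  intro c hc
  rcases lt_or_ge c δ with hcδ | hcδ
  · refine (hcount c ⟨hc, hcδ⟩ _ (hcard c)).trans ?_
    gcongr
    exact le_max_left _ _
  rcases Nat.eq_zero_or_pos ((Finset.range n).filter fun i => c ≤ a i).card with h0 | h0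
  · rw [h0, Nat.cast_zero]
    positivity
  have hcR : c ≤ 2 * R + 1 := by
    have hone : (1 : Ordinal.{w}) ≤ Ordinal.omega0 ^ ξ *
        (((Finset.range n).filter fun i => c ≤ a i).card : Ordinal.{w}) := by
      rw [Order.one_le_iff_pos]
      exact mul_pos (Ordinal.opow_pos ξ Ordinal.omega0_pos) (by exact_mod_cast h0)
    have hne' := hcard c
    rw [derivIter_eq_seminormIter] at hne'
    obtain ⟨x, hx⟩ := hne'.mono (seminormIter_subset_seminormDeriv hone)
    obtain ⟨y, hy, z, hz, hyz⟩ := hx.2 hc Set.univ univ_mem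
    have := map_sub_le_add (dualSeminorm 𝕜 X) y z
    linarith [hR y hy.2, hR z hz.2]
  have hmono : (((Finset.range n).filter fun i => c ≤ a i).card : ℝ) ≤
      ((Finset.range n).filter fun i => δ / 2 ≤ a i).card := by
    refine Nat.cast_le.2 (Finset.card_le_card fun i hi => ?_)
    rw [Finset.mem_filter] at hi ⊢
    exact ⟨hi.1, by linarith [hi.2]⟩
  refine hmono.trans ((hcount (δ / 2) ⟨by positivity, by linarith⟩ _ (hcard _)).trans ?_)
  refine Real.rpow_le_rpow (by positivity) ?_ hr.le
  rw [le_div_iff₀ hc]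
  calc 1 / (δ / 2) * c ≤ 1 / (δ / 2) * (2 * R + 1) := by gcongr
    _ = (2 * R + 1) / (δ / 2) := by ring
    _ ≤ B := le_max_right _ _

theorem powerType_weakStarAbsCo [CompleteSpace X] {K : Set (WeakDual 𝕜 X)} (hK : IsCompact K)
    {ξ : Ordinal.{w}}
    (h : ((Ordinal.omega0 ^ ξ : Ordinal.{w}) : WithTop Ordinal.{w}) < szlenk K) :
    powerType ξ (weakStarAbsCo K) = max (powerType ξ K) 1 := by
  have hcomp := isCompact_weakStarAbsCo hK
  refine le_antisymm (le_of_forall_gt_imp_ge_of_dense fun b hb => ?_)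
    (max_le (powerType_mono (subset_weakStarAbsCo K) hcomp ξ)
      (one_le_powerType_weakStarAbsCo hK h))
  -- Two exponents are needed: counting with `r` gives summability only for `q > r`. The maximum
  -- with `1` ensures `q ≥ 1`, as passing to the hull requires.
  obtain ⟨q, hq, hqb⟩ := EReal.lt_iff_exists_real_btwn.1 hb
  obtain ⟨r, hr, hrq⟩ := EReal.lt_iff_exists_real_btwn.1 hq
  have hr1 : 1 < r := by exact_mod_cast (le_max_right _ _).trans_lt hr
  have hrq' : r < q := by exact_mod_cast hrq
  have hsum := hasSummable_of_powerType_lt hK (zero_lt_one.trans hr1) hrq'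
    ((le_max_left _ _).trans_lt hr)
  obtain ⟨M, hM, hM'⟩ := (hasSummable_weakStarAbsCo_iff (hr1.trans hrq').le hK).1 hsum
  exact (hM'.powerType_le hM (by linarith)).trans hqb.le

theorem powerType_eq_zero {K : Set (WeakDual 𝕜 X)} {ξ : Ordinal.{w}}
    (h : szlenk K ≤ ((Ordinal.omega0 ^ ξ : Ordinal.{w}) : WithTop Ordinal.{w})) :
    powerType ξ K = 0 := by
  have hle : szlenk K ≤ ((Ordinal.omega0 ^ (ξ + 1) : Ordinal.{w}) : WithTop Ordinal.{w}) :=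
    h.trans (WithTop.coe_le_coe.2 (Ordinal.opow_le_opow_right Ordinal.omega0_pos (by simp)))
  rw [powerType, if_pos hle]
  have : (fun ε : ℝ => ((Real.log (szlenkNat ξ K ε) / |Real.log ε| : ℝ) : EReal)) =ᶠ[𝓝[>] 0]
      fun _ => 0 := by
    filter_upwards [self_mem_nhdsWithin] with ε hε
    have h1 : szlenkNat ξ K ε ≤ 1 :=
      szlenkNat_le (by rw [Nat.cast_one, mul_one]; exact szlenk_le_iff.1 h ε hε)
    -- The value `0` is harmless, since `Real.log 0 = 0`.
    have h2 : Real.log (szlenkNat ξ K ε) = 0 := by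
      interval_cases szlenkNat ξ K ε <;> simp
    rw [h2, zero_div, EReal.coe_zero]
  rw [limsup_congr this, limsup_const]

/-- The hypothesis amounts to summability with constant `0`: no positive parameter leaves anything.
The hull has constant `8 * 0 = 0`. -/
theorem szlenk_weakStarAbsCo_le [CompleteSpace X] {K : Set (WeakDual 𝕜 X)} (hK : IsCompact K)
    {ξ : Ordinal.{w}}
    (h : szlenk K ≤ ((Ordinal.omega0 ^ ξ : Ordinal.{w}) : WithTop Ordinal.{w})) :
    szlenk (weakStarAbsCo K) ≤ ((Ordinal.omega0 ^ ξ : Ordinal.{w}) : WithTop Ordinal.{w}) := by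
  have hsum : HasSummableWith 0 ξ 1 K := by
    rw [hasSummableWith_iff]
    intro n a ha hne
    rw [Finset.sum_eq_zero, Real.zero_rpow one_ne_zero]
    intro i hi
    rw [Real.rpow_one]
    by_contra hai
    have hpos : 0 < a i := lt_of_le_of_ne (ha i) (Ne.symm hai)
    obtain ⟨x, hx⟩ := hne.mono (seminormSeq_subset_iter_card _ a (a i) n)
    have hone : (1 : Ordinal.{w}) ≤
        (((Finset.range n).filter fun j => a i ≤ a j).card : Ordinal.{w}) := by
      rw [Order.one_le_iff_pos]
      exact_mod_cast Finset.card_pos.2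
        ⟨i, (Finset.mem_filter (p := fun j => a i ≤ a j)).2 ⟨hi, le_rfl⟩⟩
    have hx' : x ∈ derivIter (a i) (Ordinal.omega0 ^ ξ) K := by
      rw [derivIter_eq_seminormIter]
      exact seminormIter_antitone _ _ _ (le_mul_of_one_le_right' hone) hx
    rw [szlenk_le_iff.1 h (a i) hpos] at hx'
    exact hx'
  have hsum' := hsum.weakStarAbsCo le_rfl le_rfl hK
  rw [mul_zero, hasSummableWith_iff] at hsum'
  refine szlenk_le_iff.2 fun ε hε => ?_
  by_contra hne
  have := hsum' 1 (fun _ => ε) (fun _ => hε.le) (Set.nonempty_iff_ne_empty.2 hne)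
  simp only [Finset.sum_const, Finset.card_range, Real.rpow_one, one_smul] at this
  linarith

end PowerType

end SzlenkIndex

end

theorem mainTheorem5 {𝕜 : Type u} [RCLike 𝕜] {X : Type v} [NormedAddCommGroup X]
    [NormedSpace 𝕜 X] [CompleteSpace X] (ξ : Ordinal.{w}) (K : Set (WeakDual 𝕜 X))
    (hK : IsCompact K) :
    (∀ q : ℝ, 1 ≤ q →
      (SzlenkIndex.HasSummable ξ q K ↔
        SzlenkIndex.HasSummable ξ q (SzlenkIndex.weakStarAbsCo K))) ∧
    (((Ordinal.omega0 ^ ξ : Ordinal.{w}) : WithTop Ordinal.{w}) < SzlenkIndex.szlenk K →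
      SzlenkIndex.powerType ξ (SzlenkIndex.weakStarAbsCo K) =
        max (SzlenkIndex.powerType ξ K) 1) ∧
    (K.Nonempty →
      SzlenkIndex.szlenk K ≤ ((Ordinal.omega0 ^ ξ : Ordinal.{w}) : WithTop Ordinal.{w}) →
        SzlenkIndex.powerType ξ K = 0 ∧
          SzlenkIndex.powerType ξ (SzlenkIndex.weakStarAbsCo K) = 0) :=
  ⟨fun _ hq => SzlenkIndex.hasSummable_weakStarAbsCo_iff hq hK,
    SzlenkIndex.powerType_weakStarAbsCo hK,
    fun _ h => ⟨SzlenkIndex.powerType_eq_zero h,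
      SzlenkIndex.powerType_eq_zero (SzlenkIndex.szlenk_weakStarAbsCo_le hK h)⟩⟩
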